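/- **Setting.** There are $n$ agents, $m\ge 2$ states of the world $\theta_1,\dots,\theta_m$ with true state $\theta_1$, and $T\ge 1$ rounds. Agent $i$ has a signal space with likelihoods (probability mass functions, or densities with respect to a common reference measure) $\ell_i(\cdot|\theta_k)$; the signals $s_{i,t}\sim\ell_i(\cdot|\theta_1)$ are independent over agents $i\in[n]$ and rounds $t\in[T]$. Assume $|\log\ell_i(\cdot|\theta_k)|\le B$ for all $i,k$, and that $\theta_1$ is globally identifiable: for every $k\ne1$ some agent $i$ does not have $\ell_i(\cdot|\theta_k)=\ell_i(\cdot|\theta_1)$ with probability one. Let $W$ be the stochastic communication matrix, $\pi$ its stationary distribution ($\pi^{\mathsf T}W=\pi^{\mathsf T}$, $\sum_i\pi(i)=1$, $\pi\ge0$), $\lambda_{\max}(W)$ the largest modulus of an eigenvalue of $W$ other than the simple eigenvalue $1$, and $\gamma(W)=1-\lambda_{\max}(W)$. Put $\mathcal I(\theta_1,\theta_k)=\sum_i\pi(i)D_{KL}(\ell_i(\cdot|\theta_1)\|\ell_i(\cdot|\theta_k))$, and let $\theta_2$ be the state that minimizes this over $k\neq1$. With $\psi_{i,t}(k)=\log\ell_i(s_{i,t}|\theta_k)$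 and $\phi_{i,0}=\phi_0=0$, let $$\phi_{i,t}=\sum_j[W]_{ij}\phi_{j,t-1}+\psi_{i,t},\qquad \phi_t=\phi_{t-1}+\sum_i\pi(i)\psi_{i,t},$$ let $\mu_{i,t}$ and $\mu_t$ be the minimizers over the probability simplex $\Delta_m$ of $-\mu^{\mathsf T}\phi_{i,t}+\frac1\eta D_{KL}(\mu\|\mu_0)$ and of $-\mu^{\mathsf T}\phi_{t}+\frac1\eta D_{KL}(\mu\|\mu_0)$, where $\mu_0$ is uniform, and let $\mathbf{Cost}_{i,T}=\sum_{t=1}^TD_{KL}(\mu_{i,t}\|\mu_t)$. **Networks.** Fix $\omega\in(0,1)$. In a graph with self-reliance $\omega$, $[W]_{ii}=\omega$ and every agent splits the weight $1-\omega$ equally among its neighbours. The graphs are the star and the cycle on $n$ vertices, and, for $n$ a perfect square, the grid with wraparounds, i.e. the Cartesian product of two cycles of length $\sqrt n$. **Claim.** For all $B>0$ and $\iota>0$ there is a constant $C$ such that for every $\delta\in(0,1)$ there is an $N$ such that for all $n\ge N$, all $\omega\in(0,1)$, all $m\ge2$, $T\ge1$, all likelihoods as above with $\mathcal I(\theta_1,\theta_2)\ge\iota$,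 and every agent $i$, the choice of learning rate $\eta=\frac{\gamma(W)}{16B\log n}$ gives, with probability at least $1-\delta$: (a) for the star network, $$\mathbf{Cost}_{i,T}\le C\,\frac{\log[nmT]}{\min\{1-\omega,\;1-|2\omega-1|\}};$$ (b) for the cycle network, $$\mathbf{Cost}_{i,T}\le C\,\frac{\log[nmT]}{\min\{1-|2\omega-1|,\;2(1-\omega)\sin^2\frac{\pi}{n}\}};$$ (c) for the grid network (with $n$ a perfect square), $$\mathbf{Cost}_{i,T}\le C\,\frac{\log[nmT]}{\min\{1-|2\omega-1|,\;2(1-\omega)\sin^2\frac{\pi}{\sqrt n}\}}.$$ (In the sines, $\pi$ is the circle constant.) -/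

import Mathlib

open MeasureTheory ProbabilityTheory

universe u v

noncomputable section

namespace DistributedDetection

/-! ### Communication matrices -/

open Classical in
/-- The communication matrix of a graph in which every agent has self-reliance `ω` and splits the
remaining weight `1 - ω` equally among its neighbours. -/
def commMatrix {V : Type} [Fintype V] (G : SimpleGraph V) (ω : ℝ) : Matrix V V ℝ :=
  Matrix.of fun i j =>
    if i = j then ω else if G.Adj i j then (1 - ω) / (G.degree i : ℝ) else 0

/-- The two-dimensional grid with wraparounds: the Cartesian product of two rings of size `k`. -/
abbrev torusGrid (k : ℕ) : SimpleGraph (Fin k × Fin k) :=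
  (SimpleGraph.cycleGraph k).boxProd (SimpleGraph.cycleGraph k)

/-- `λ_max(W)`: the largest modulus of an eigenvalue of `W` other than the Perron eigenvalue `1`.
(It is used for irreducible stochastic matrices, whose eigenvalue `1` is simple, so that it is
`max {|λ₂|, |λₙ|}`.) -/
def secondModulus {V : Type} [Fintype V] [DecidableEq V] (W : Matrix V V ℝ) : ℝ :=
  sSup {x : ℝ | ∃ z ∈ spectrum ℂ (W.map ((↑) : ℝ → ℂ)), z ≠ 1 ∧ x = ‖z‖}

/-- The spectral gap `γ(W) = 1 - λ_max(W)`. -/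
def spectralGap {V : Type} [Fintype V] [DecidableEq V] (W : Matrix V V ℝ) : ℝ :=
  1 - secondModulus W

/-- The eigenvector centrality: a probability vector with `π i = ∑ j, W j i * π j`. -/
structure IsCentrality {V : Type} [Fintype V] (W : Matrix V V ℝ) (π : V → ℝ) : Prop where
  nonneg : ∀ i, 0 ≤ π i
  sum_eq_one : ∑ i, π i = 1
  stationary : ∀ i, π i = ∑ j, W j i * π j

/-! ### Observation model -/

/-- Marginal likelihoods of the agents `V` under `m` states of the world: agent `i` has a signal
space `S i` and, for each state `k`, a probability density `lik i k` with respect to a reference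
measure `ref i` (for a discrete signal space, the counting measure). -/
structure SignalModel (V : Type) (m : ℕ) where
  S : V → Type u
  meas : ∀ i, MeasurableSpace (S i)
  ref : ∀ i, Measure (S i)
  lik : ∀ i, Fin m → S i → ℝ
  lik_nonneg : ∀ i k x, 0 ≤ lik i k x
  lik_measurable : ∀ i k, Measurable (lik i k)
  lik_normalized : ∀ i k, ∫⁻ x, ENNReal.ofReal (lik i k x) ∂(ref i) = 1

namespace SignalModel

instance {V : Type} {m : ℕ} (M : SignalModel.{u} V m) (i : V) : MeasurableSpace (M.S i) :=
  M.meas i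

variable {V : Type} {m : ℕ}

/-- The distribution of a signal of agent `i` when the state of the world is `k`. -/
def law (M : SignalModel.{u} V m) (i : V) (k : Fin m) : Measure (M.S i) :=
  (M.ref i).withDensity fun x => ENNReal.ofReal (M.lik i k x)

/-- All log-marginals are bounded by `B` in absolute value. -/
def LogBounded (M : SignalModel.{u} V m) (B : ℝ) : Prop :=
  ∀ i k x, 0 < M.lik i k x ∧ |Real.log (M.lik i k x)| ≤ B

/-- Global identifiability: no state other than the true state `θ` is observationally equivalent
to `θ` for all agents. -/
def Identifiable (M : SignalModel.{u} V m) (θ : Fin m) : Prop :=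
  ∀ k, (∀ i, ∀ᵐ x ∂(M.law i θ), M.lik i k x = M.lik i θ x) → k = θ

/-- `I(θ, k) = ∑ i, π i * D_KL(ℓ_i(·|θ) ‖ ℓ_i(·|k))`. -/
def info [Fintype V] (M : SignalModel.{u} V m) (π : V → ℝ) (θ k : Fin m) : ℝ :=
  ∑ i, π i * (InformationTheory.klDiv (M.law i θ) (M.law i k)).toReal

/-- The random signals `s t i` of the rounds `t = 1, …, T` are independent over rounds and agents,
and those of agent `i` are distributed according to `ℓ_i(·|θ)`. -/
structure IsSignalSequence (M : SignalModel.{u} V m) (θ : Fin m) (T : ℕ)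
    {Ω : Type v} [MeasurableSpace Ω] (P : Measure Ω) (s : ℕ → ∀ i, Ω → M.S i) : Prop where
  hasLaw : ∀ t ∈ Set.Icc 1 T, ∀ i, HasLaw (s t i) (M.law i θ) P
  indep : iIndepFun (fun p : Set.Icc 1 T × V => s p.1 p.2) P

/-- The log-marginals `ψ_{i,t}(k) = log ℓ_i(s_{i,t} | k)` of a realization of the signals. -/
def logLik (M : SignalModel.{u} V m) (s : ℕ → ∀ i, M.S i) (t : ℕ) (i : V) (k : Fin m) : ℝ :=
  Real.log (M.lik i k (s t i))

end SignalModel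

/-! ### The two algorithms and the decentralization cost -/

/-- Kullback-Leibler divergence of probability vectors. -/
def klVec {m : ℕ} (p q : Fin m → ℝ) : ℝ := ∑ k, p k * Real.log (p k / q k)

/-- The belief formed from the accumulated log-marginals `φ`: a minimizer over the probability
simplex of `-⟨μ, φ⟩ + D_KL(μ ‖ μ₀) / η`, where the prior `μ₀` is uniform. -/
structure IsBelief {m : ℕ} (η : ℝ) (φ μ : Fin m → ℝ) : Prop where
  mem_simplex : μ ∈ stdSimplex ℝ (Fin m)
  isMinOn : IsMinOn (fun p : Fin m → ℝ => -(∑ k, p k * φ k) + 1 / η * klVec p fun _ => 1 / (m : ℝ))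
    (stdSimplex ℝ (Fin m)) μ

/-- Accumulation in centralized detection: `φ_t = φ_{t-1} + ∑ i, π i ψ_{i,t}`, `φ_0 = 0`. -/
def centralPhi {V : Type} [Fintype V] {m : ℕ} (π : V → ℝ) (ψ : ℕ → V → Fin m → ℝ) :
    ℕ → Fin m → ℝ
  | 0 => fun _ => 0
  | t + 1 => fun k => centralPhi π ψ t k + ∑ i, π i * ψ (t + 1) i k

/-- Accumulation in distributed detection: `φ_{i,t} = ∑ j, W i j φ_{j,t-1} + ψ_{i,t}`,
`φ_{i,0} = 0`. -/
def agentPhi {V : Type} [Fintype V] {m : ℕ} (W : Matrix V V ℝ) (ψ : ℕ → V → Fin m → ℝ) :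
    ℕ → V → Fin m → ℝ
  | 0 => fun _ _ => 0
  | t + 1 => fun i k => ∑ j, W i j * agentPhi W ψ t j k + ψ (t + 1) i k

/-- The decentralization cost `∑_{t=1}^T D_KL(μ_{i,t} ‖ μ_t)`. -/
def decentralizationCost {m : ℕ} (T : ℕ) (μAgent μCentral : ℕ → Fin m → ℝ) : ℝ :=
  ∑ t ∈ Finset.Icc 1 T, klVec (μAgent t) (μCentral t)

/-- For every problem on the network with communication matrix `W` (numbers `m ≥ 2` of states and
`T ≥ 1` of rounds, a signal model, a true state) with log-marginals bounded by `B`, globally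
identifiable true state `θ`, and `I(θ, k) ≥ ι` for every other state `k` (that is, for the second
best one), both algorithms being run with the learning rate `η = γ(W) / (16 B log n)`: the
decentralization cost of each agent is at most `bound m T` with probability at least `1 - δ`. -/
def CostBound {V : Type} [Fintype V] [DecidableEq V] (W : Matrix V V ℝ) (B ι δ : ℝ)
    (bound : ℕ → ℕ → ℝ) : Prop :=
  ∀ m T : ℕ, 2 ≤ m → 1 ≤ T →
  ∀ (M : SignalModel.{u} V m) (θ : Fin m), M.LogBounded B → M.Identifiable θ →
  ∀ π : V → ℝ, IsCentrality W π → (∀ k, k ≠ θ → ι ≤ M.info π θ k) →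
  ∀ (Ω : Type v) [MeasurableSpace Ω] (P : Measure Ω) [IsProbabilityMeasure P]
    (s : ℕ → ∀ i, Ω → M.S i), M.IsSignalSequence θ T P s →
  ∀ η : ℝ, η = spectralGap W / (16 * B * Real.log (Fintype.card V)) →
  ∀ (i : V) (μAgent μCentral : Ω → ℕ → Fin m → ℝ),
    (∀ ω, ∀ t ∈ Finset.Icc 1 T,
      IsBelief η (agentPhi W (M.logLik fun t i => s t i ω) t i) (μAgent ω t)) →
    (∀ ω, ∀ t ∈ Finset.Icc 1 T,
      IsBelief η (centralPhi π (M.logLik fun t i => s t i ω) t) (μCentral ω t)) →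
    ENNReal.ofReal (1 - δ) ≤
      P {ω | decentralizationCost T (μAgent ω) (μCentral ω) ≤ bound m T}

end DistributedDetection

end

/-! Both beliefs are Gibbs distributions with potentials `η * φ`, so the cost is controlled by
comparing the two accumulations. Unrolling the recursions, a log-marginal of age `s` enters with
weights `(W ^ s) i j` for the agent and `π j` for the centre. If `S` bounds the sum over `s` of the
`ℓ¹` distances between these weights (`MixesWithin`), the accumulations differ by at most `B * S` at
all times, and each round costs at most `2 η B S`.

Only a burn-in period costs that much. By Hoeffding's inequality and a union bound, outside an event
of probability at most `T m exp (-Λ) = 1 / n`, where `Λ = log (n m T)`, every centralized log-ratio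
against the truth falls below `-t ι / 2` once `t` is of order `Λ`. After a burn-in of order `Λ + S +
Λ / η` both beliefs put weight at most `1 / (m T)` on each false state, and the remaining rounds
together cost `O(1)`. Multiplying the burn-in by `2 η B S` gives `O(Λ / γ)`, provided that `S` times
the gap is bounded by an absolute constant (`costBound_of_mixesWithin`).

The generic estimate of `S` from the second eigenvalue loses a factor `log n`, so `S` is bounded
through the whole spectrum. On the star and the cycle, `W ^ s` is expanded in explicit eigenmatrices
whose rows have `ℓ¹` norm at most `2`, and the sums of `1 / (1 - |λ|)` are estimated
(`mixesWithin_of_resolution`); on the cycle they converge like the sum of `1 / q ^ 2`. Over the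
modes of the grid this sum would again lose a logarithm. There `W` is instead the average of two
commuting copies of the cycle walk, and a binomial expansion transfers the bound for the cycle at
the price of a factor `4` (`MixesWithin.average`). -/

namespace DistributedDetection

/-! ### Gibbs distributions and beliefs -/

/-- The Gibbs distribution with potential `a`. -/
noncomputable def gibbs {m : ℕ} (a : Fin m → ℝ) (k : Fin m) : ℝ :=
  Real.exp (a k) / ∑ l, Real.exp (a l)

section Gibbs

variable {m : ℕ}

lemma sum_exp_pos (hm : 0 < m) (a : Fin m → ℝ) : 0 < ∑ l, Real.exp (a l) := by
  have : Nonempty (Fin m) := ⟨⟨0, hm⟩⟩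
  exact Finset.sum_pos (fun _ _ => Real.exp_pos _) Finset.univ_nonempty

lemma gibbs_pos (hm : 0 < m) (a : Fin m → ℝ) (k : Fin m) : 0 < gibbs a k :=
  div_pos (Real.exp_pos _) (sum_exp_pos hm a)

lemma gibbs_sum (hm : 0 < m) (a : Fin m → ℝ) : ∑ k, gibbs a k = 1 := by
  simp only [gibbs, ← Finset.sum_div]
  exact div_self (sum_exp_pos hm a).ne'

lemma gibbs_mem (hm : 0 < m) (a : Fin m → ℝ) : gibbs a ∈ stdSimplex ℝ (Fin m) :=
  ⟨fun k => (gibbs_pos hm a k).le, gibbs_sum hm a⟩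

lemma log_gibbs (hm : 0 < m) (a : Fin m → ℝ) (k : Fin m) :
    Real.log (gibbs a k) = a k - Real.log (∑ l, Real.exp (a l)) := by
  rw [gibbs, Real.log_div (Real.exp_pos _).ne' (sum_exp_pos hm a).ne', Real.log_exp]

lemma mul_log_div (x : ℝ) {y : ℝ} (hy : y ≠ 0) :
    x * Real.log (x / y) = x * Real.log x - x * Real.log y := by
  rcases eq_or_ne x 0 with rfl | hx
  · simp
  · rw [Real.log_div hx hy]; ring

lemma klVec_eq {p q : Fin m → ℝ} (hq : ∀ k, q k ≠ 0) :
    klVec p q = ∑ k, p k * Real.log (p k) - ∑ k, p k * Real.log (q k) := by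
  rw [klVec, ← Finset.sum_sub_distrib]
  exact Finset.sum_congr rfl fun k _ => mul_log_div _ (hq k)

lemma klVec_gibbs_right (hm : 0 < m) {p : Fin m → ℝ} (hp : ∑ k, p k = 1) (a : Fin m → ℝ) :
    klVec p (gibbs a) =
      ∑ k, p k * Real.log (p k) - ∑ k, p k * a k + Real.log (∑ l, Real.exp (a l)) := by
  rw [klVec_eq fun k => (gibbs_pos hm a k).ne']
  simp only [log_gibbs hm, mul_sub, Finset.sum_sub_distrib, ← Finset.sum_mul, hp]
  ring

/-- The equality case of Gibbs' inequality: since `p` and `q` have equal mass, the divergence is a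
sum of nonnegative terms `q k * klFun (p k / q k)`, each vanishing only at ratio `1`. -/
lemma eq_of_klVec_nonpos {p q : Fin m → ℝ} (hp : p ∈ stdSimplex ℝ (Fin m))
    (hq : ∀ k, 0 < q k) (hq1 : ∑ k, q k = 1) (h : klVec p q ≤ 0) : p = q := by
  have hterm : ∀ k, q k * InformationTheory.klFun (p k / q k) =
      p k * Real.log (p k / q k) + q k - p k := fun k => by
    have := (hq k).ne'
    rw [InformationTheory.klFun]; field_simp
  have hnn : ∀ k ∈ Finset.univ, 0 ≤ q k * InformationTheory.klFun (p k / q k) := fun k _ =>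
    mul_nonneg (hq k).le (InformationTheory.klFun_nonneg (div_nonneg (hp.1 k) (hq k).le))
  have hsum : ∑ k, q k * InformationTheory.klFun (p k / q k) = 0 := by
    refine le_antisymm ?_ (Finset.sum_nonneg hnn)
    simp only [hterm, Finset.sum_sub_distrib, Finset.sum_add_distrib, hq1, hp.2]
    simpa [klVec] using h
  funext k
  have hk := (Finset.sum_eq_zero_iff_of_nonneg hnn).1 hsum k (Finset.mem_univ k)
  have := (mul_eq_zero.1 hk).resolve_left (hq k).ne'
  rw [InformationTheory.klFun_eq_zero_iff (div_nonneg (hp.1 k) (hq k).le)] at this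
  exact (div_eq_one_iff_eq (hq k).ne').1 this

/-- Gibbs' variational principle: up to an additive constant, to which the uniform prior contributes
`log m`, the objective is `1 / η` times the divergence from the Gibbs distribution. -/
lemma IsBelief.eq_gibbs {η : ℝ} (hη : 0 < η) (hm : 0 < m) {φ μ : Fin m → ℝ}
    (h : IsBelief η φ μ) : μ = gibbs fun k => η * φ k := by
  set a : Fin m → ℝ := fun k => η * φ k with ha
  have hm' : (0 : ℝ) < m := by exact_mod_cast hm
  have hobj : ∀ p ∈ stdSimplex ℝ (Fin m),
      -(∑ k, p k * φ k) + 1 / η * klVec p (fun _ => 1 / (m : ℝ)) =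
        1 / η * (klVec p (gibbs a) - Real.log (∑ l, Real.exp (a l)) + Real.log m) := by
    intro p hp
    rw [klVec_gibbs_right hm hp.2, klVec_eq fun _ => (one_div_pos.2 hm').ne']
    have : ∑ k, p k * a k = η * ∑ k, p k * φ k := by
      rw [Finset.mul_sum]; exact Finset.sum_congr rfl fun k _ => by rw [ha]; ring
    rw [this, ← Finset.sum_mul, hp.2, one_div (m : ℝ), Real.log_inv]
    field_simp
    ring
  have hself : klVec (gibbs a) (gibbs a) = 0 := by
    rw [klVec]
    exact Finset.sum_eq_zero fun k _ => by rw [div_self (gibbs_pos hm a k).ne']; simp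
  have hmin := h.isMinOn (gibbs_mem hm a)
  simp only [Set.mem_ofPred_eq] at hmin
  rw [hobj _ h.mem_simplex, hobj _ (gibbs_mem hm a), hself] at hmin
  have := le_of_mul_le_mul_left hmin (one_div_pos.2 hη)
  exact eq_of_klVec_nonpos h.mem_simplex (gibbs_pos hm a) (gibbs_sum hm a) (by linarith)

lemma klVec_gibbs (hm : 0 < m) (a b : Fin m → ℝ) :
    klVec (gibbs a) (gibbs b) = ∑ k, gibbs a k * (a k - b k)
      + Real.log (∑ l, Real.exp (b l)) - Real.log (∑ l, Real.exp (a l)) := by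
  rw [klVec_gibbs_right hm (gibbs_sum hm a)]
  simp only [log_gibbs hm, mul_sub, Finset.sum_sub_distrib, ← Finset.sum_mul, gibbs_sum hm]
  ring

/-- The mean of `a - b` and the difference of the log-partition functions cost `d` each, the latter
being 1-Lipschitz in the sup norm. This serves the burn-in rounds. -/
lemma klVec_gibbs_le (hm : 0 < m) {a b : Fin m → ℝ} {d : ℝ} (h : ∀ k, |a k - b k| ≤ d) :
    klVec (gibbs a) (gibbs b) ≤ 2 * d := by
  rw [klVec_gibbs hm]
  have h1 : ∑ k, gibbs a k * (a k - b k) ≤ d := by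
    calc ∑ k, gibbs a k * (a k - b k) ≤ ∑ k, gibbs a k * d :=
          Finset.sum_le_sum fun k _ =>
            mul_le_mul_of_nonneg_left ((le_abs_self _).trans (h k)) (gibbs_pos hm a k).le
      _ = d := by rw [← Finset.sum_mul, gibbs_sum hm, one_mul]
  have h2 : Real.log (∑ l, Real.exp (b l)) ≤ d + Real.log (∑ l, Real.exp (a l)) := by
    rw [← Real.log_exp d, ← Real.log_mul (Real.exp_pos d).ne' (sum_exp_pos hm a).ne',
      Finset.mul_sum]
    refine Real.log_le_log (sum_exp_pos hm b) (Finset.sum_le_sum fun k _ => ?_)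
    rw [← Real.exp_add, Real.exp_le_exp]
    linarith [(abs_le.1 (h k)).1]
  linarith

/-- Measured relative to their values at `θ`, the potentials contribute only through false states,
whose weights are at most `exp (-L)`. The log-partition functions are close to `a θ` and `b θ`, by
`log x ≤ x - 1` for the upper bound. This serves the rounds after the burn-in. -/
lemma klVec_gibbs_le_of_gap (θ : Fin m) {a b : Fin m → ℝ} {d L : ℝ}
    (h : ∀ k, |a k - b k| ≤ d) (ha : ∀ k, k ≠ θ → a k - a θ ≤ -L)
    (hb : ∀ k, k ≠ θ → b k - b θ ≤ -L) :
    klVec (gibbs a) (gibbs b) ≤ m * Real.exp (-L) * (1 + 2 * d) := by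
  have hm : 0 < m := θ.pos
  have hd : 0 ≤ d := (abs_nonneg _).trans (h θ)
  have hcount : ∀ c : ℝ, 0 ≤ c → ∑ _k ∈ Finset.univ.erase θ, c ≤ m * c := fun c hc => by
    rw [Finset.sum_const, nsmul_eq_mul]
    refine mul_le_mul_of_nonneg_right ?_ hc
    exact_mod_cast (Finset.card_le_univ _).trans (by simp)
  have hsum : ∑ k, gibbs a k * (a k - b k) ≤ a θ - b θ + m * Real.exp (-L) * (2 * d) := by
    have e : ∑ k, gibbs a k * (a k - b k) =
        a θ - b θ + ∑ k, gibbs a k * ((a k - b k) - (a θ - b θ)) := by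
      simp only [mul_sub, Finset.sum_sub_distrib, ← Finset.sum_mul, gibbs_sum hm]; ring
    rw [e, ← Finset.add_sum_erase _ _ (Finset.mem_univ θ), sub_self, mul_zero, zero_add]
    gcongr
    rw [mul_assoc]
    refine (Finset.sum_le_sum fun k hk => ?_).trans (hcount (Real.exp (-L) * (2 * d)) (by positivity))
    have h1 : gibbs a k ≤ Real.exp (-L) := by
      rw [gibbs, div_le_iff₀ (sum_exp_pos hm a)]
      calc Real.exp (a k) ≤ Real.exp (-L) * Real.exp (a θ) := by
            rw [← Real.exp_add, Real.exp_le_exp]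
            linarith [ha k (Finset.ne_of_mem_erase hk)]
        _ ≤ _ := by
            gcongr
            exact Finset.single_le_sum (f := fun l => Real.exp (a l))
              (fun _ _ => (Real.exp_pos _).le) (Finset.mem_univ θ)
    have h2 : (a k - b k) - (a θ - b θ) ≤ 2 * d := by
      linarith [(abs_le.1 (h k)).2, (abs_le.1 (h θ)).1]
    calc gibbs a k * ((a k - b k) - (a θ - b θ)) ≤ gibbs a k * (2 * d) :=
          mul_le_mul_of_nonneg_left h2 (gibbs_pos hm a k).le
      _ ≤ _ := by gcongr
  have hZa : a θ ≤ Real.log (∑ l, Real.exp (a l)) := by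
    rw [Real.le_log_iff_exp_le (sum_exp_pos hm a)]
    exact Finset.single_le_sum (f := fun l => Real.exp (a l))
      (fun _ _ => (Real.exp_pos _).le) (Finset.mem_univ θ)
  have hZb : Real.log (∑ l, Real.exp (b l)) ≤ b θ + m * Real.exp (-L) := by
    have e : ∑ l, Real.exp (b l) = Real.exp (b θ) * ∑ l, Real.exp (b l - b θ) := by
      rw [Finset.mul_sum]
      exact Finset.sum_congr rfl fun k _ => by rw [← Real.exp_add]; congr 1; ring
    rw [e, Real.log_mul (Real.exp_pos _).ne' (sum_exp_pos hm _).ne', Real.log_exp]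
    gcongr
    refine (Real.log_le_sub_one_of_pos (sum_exp_pos hm _)).trans ?_
    rw [← Finset.add_sum_erase _ _ (Finset.mem_univ θ), sub_self, Real.exp_zero, add_sub_cancel_left]
    refine (Finset.sum_le_sum fun k hk => ?_).trans (hcount _ (Real.exp_pos (-L)).le)
    exact Real.exp_le_exp.2 (hb k (Finset.ne_of_mem_erase hk))
  rw [klVec_gibbs hm]
  nlinarith [hsum, hZa, hZb]

end Gibbs

/-! ### Concentration of the centralized log-likelihood ratios -/

lemma centralPhi_eq_sum {V : Type} [Fintype V] {m : ℕ} (π : V → ℝ) (ψ : ℕ → V → Fin m → ℝ)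
    (t : ℕ) (k : Fin m) :
    centralPhi π ψ t k = ∑ τ ∈ Finset.Icc 1 t, ∑ i, π i * ψ τ i k := by
  induction t with
  | zero => simp [centralPhi]
  | succ t ih => rw [Finset.sum_Icc_succ_top (by omega), ← ih]; rfl

namespace SignalModel

variable {V : Type} {m : ℕ}

lemma isProbabilityMeasure_law (M : SignalModel.{u} V m) (i : V) (k : Fin m) :
    IsProbabilityMeasure (M.law i k) :=
  ⟨by rw [law, withDensity_apply _ MeasurableSet.univ, setLIntegral_univ, M.lik_normalized]⟩

variable {M : SignalModel.{u} V m} {B : ℝ}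

/-- Positivity of the likelihoods everywhere makes their ratio the density of one law against the
other, which turns the abstract divergence into a mean log-likelihood ratio. -/
lemma LogBounded.law_eq_withDensity (h : M.LogBounded B) (i : V) (θ k : Fin m) :
    M.law i θ = (M.law i k).withDensity fun x => ENNReal.ofReal (M.lik i θ x / M.lik i k x) := by
  have hθ := M.lik_measurable i θ
  have hk := M.lik_measurable i k
  have hθk : Measurable fun x => M.lik i θ x / M.lik i k x := hθ.div hk
  rw [law, law, ← withDensity_mul _ hk.ennreal_ofReal hθk.ennreal_ofReal]
  congr 1
  funext x
  have := (h i k x).1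
  rw [Pi.mul_apply, ← ENNReal.ofReal_mul this.le, mul_div_cancel₀ _ this.ne']

lemma LogBounded.toReal_klDiv (h : M.LogBounded B) (i : V) (θ k : Fin m) :
    (InformationTheory.klDiv (M.law i θ) (M.law i k)).toReal =
      ∫ x, (Real.log (M.lik i θ x) - Real.log (M.lik i k x)) ∂(M.law i θ) := by
  have hθ := M.lik_measurable i θ
  have hk := M.lik_measurable i k
  have hθk : Measurable fun x => M.lik i θ x / M.lik i k x := hθ.div hk
  have := M.isProbabilityMeasure_law i θ
  have := M.isProbabilityMeasure_law i k
  have hac : M.law i θ ≪ M.law i k := by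
    rw [h.law_eq_withDensity i θ k]
    exact withDensity_absolutelyContinuous _ _
  rw [InformationTheory.toReal_klDiv_of_measure_eq hac (by simp)]
  refine integral_congr_ae (hac.ae_le ?_)
  have hd := Measure.rnDeriv_withDensity (M.law i k) hθk.ennreal_ofReal
  filter_upwards [hd] with x hx
  have h1 := (h i θ x).1
  have h2 := (h i k x).1
  rw [llr, h.law_eq_withDensity i θ k]
  rw [hx, ENNReal.toReal_ofReal (div_pos h1 h2).le, Real.log_div h1.ne' h2.ne']

variable {Ω : Type v} [MeasurableSpace Ω] {P : Measure Ω} [IsProbabilityMeasure P]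
  {s : ℕ → ∀ i, Ω → M.S i} {θ : Fin m} {T : ℕ}

/-- The centralized log-likelihood ratio of a false state against the true one exceeds half of its
mean (which is negative) with exponentially small probability. -/
lemma IsSignalSequence.measure_centralPhi_sub_ge_le [Fintype V] (hB : 0 < B)
    (hM : M.LogBounded B) (hs : M.IsSignalSequence θ T P s) {π : V → ℝ} (hπ : ∀ i, 0 ≤ π i)
    (hπ1 : ∑ i, π i = 1) {k : Fin m} {ι : ℝ} (hι : 0 < ι) (hinfo : ι ≤ M.info π θ k)
    {t : ℕ} (ht : 1 ≤ t) (htT : t ≤ T) :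
    P {ω | -(t * ι / 2) ≤ centralPhi π (M.logLik fun t i => s t i ω) t k -
        centralPhi π (M.logLik fun t i => s t i ω) t θ} ≤
      ENNReal.ofReal (Real.exp (-(t * ι ^ 2 / (32 * B ^ 2)))) := by
  let g : ∀ i : V, M.S i → ℝ := fun i x =>
    π i * (Real.log (M.lik i k x) - Real.log (M.lik i θ x))
  have hg : ∀ i, Measurable (g i) := fun i =>
    ((M.lik_measurable i k).log.sub (M.lik_measurable i θ).log).const_mul _
  let X : Set.Icc 1 T × V → Ω → ℝ := fun p ω => g p.2 (s p.1 p.2 ω)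
  have hXmean : ∀ p, P[X p] =
      -(π p.2 * (InformationTheory.klDiv (M.law p.2 θ) (M.law p.2 k)).toReal) := fun p => by
    rw [hM.toReal_klDiv, ← mul_neg, ← integral_neg, ← integral_const_mul]
    rw [← (hs.hasLaw p.1 p.1.2 p.2).integral_comp]
    · refine integral_congr_ae (ae_of_all _ fun ω => ?_)
      simp [X, g]
    · exact ((((M.lik_measurable p.2 θ).log.sub (M.lik_measurable p.2 k).log).neg).const_mul
        (π p.2)).aestronglyMeasurable
  have hXmeas : ∀ p, AEMeasurable (X p) P := fun p =>
    (hg p.2).comp_aemeasurable (hs.hasLaw p.1 p.1.2 p.2).aemeasurable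
  have hXmem : ∀ p ω, X p ω ∈ Set.Icc (-(2 * B * π p.2)) (2 * B * π p.2) := fun p ω => by
    have h1 := abs_le.1 (hM p.2 k (s p.1 p.2 ω)).2
    have h2 := abs_le.1 (hM p.2 θ (s p.1 p.2 ω)).2
    have h3 := hπ p.2
    constructor <;> simp only [X, g] <;> nlinarith
  have hsub : ∀ p, HasSubgaussianMGF (fun ω => X p ω - P[X p])
      ((‖2 * B * π p.2 - -(2 * B * π p.2)‖₊ / 2) ^ 2) P := fun p =>
    hasSubgaussianMGF_of_mem_Icc (hXmeas p) (ae_of_all _ (hXmem p))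
  let e : Set.Icc 1 T × V → ℝ := fun p => P[X p]
  have hindep : iIndepFun (fun p ω => X p ω - P[X p]) P :=
    hs.indep.comp (fun p x => g p.2 x - e p) fun p => (hg p.2).sub_const _
  let F : Finset (Set.Icc 1 T × V) :=
    ((Finset.Icc 1 t).subtype (· ∈ Set.Icc 1 T)) ×ˢ Finset.univ
  have hFsum : ∀ f : ℕ → V → ℝ, ∑ p ∈ F, f p.1 p.2 = ∑ τ ∈ Finset.Icc 1 t, ∑ i, f τ i := by
    intro f
    rw [Finset.sum_product]
    exact Finset.sum_subtype_of_mem (fun τ => ∑ i, f τ i) fun τ hτ => by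
      rw [Finset.mem_Icc] at hτ
      exact ⟨hτ.1, hτ.2.trans htT⟩
  have htpos : (0 : ℝ) < t := by exact_mod_cast ht
  have hH := HasSubgaussianMGF.measure_sum_ge_le_of_iIndepFun hindep (s := F)
    (fun p _ => hsub p) (ε := t * ι / 2) (by positivity)
  have hset : {ω | -(t * ι / 2) ≤ centralPhi π (M.logLik fun t i => s t i ω) t k -
      centralPhi π (M.logLik fun t i => s t i ω) t θ} ⊆
      {ω | t * ι / 2 ≤ ∑ p ∈ F, (X p ω - P[X p])} := by
    intro ω hω
    simp only [Set.mem_ofPred_eq] at hω ⊢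
    have he : ∑ p ∈ F, (X p ω - P[X p]) = (centralPhi π (M.logLik fun t i => s t i ω) t k -
        centralPhi π (M.logLik fun t i => s t i ω) t θ) + t * M.info π θ k := by
      simp only [hXmean, sub_neg_eq_add, X]
      rw [hFsum fun τ i => g i (s τ i ω) +
        π i * (InformationTheory.klDiv (M.law i θ) (M.law i k)).toReal]
      simp only [Finset.sum_add_distrib, centralPhi_eq_sum, ← Finset.sum_sub_distrib]
      congr 1
      · refine Finset.sum_congr rfl fun τ _ => Finset.sum_congr rfl fun i _ => ?_
        simp only [g, logLik]; ring
      · simp [info]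
    rw [he]
    nlinarith
  -- The variance proxy. Each summand has half-range `2 B π i`, so `c = 4 B² t ∑ π i²`; with
  -- deviation `t ι / 2` the exponent is `t ι² / (32 B² ∑ π i²)`, and `∑ π i² ≤ 1` gives the claim.
  set c : NNReal := ∑ p ∈ F, (‖2 * B * π p.2 - -(2 * B * π p.2)‖₊ / 2) ^ 2
  have hc : (c : ℝ) = 4 * B ^ 2 * t * ∑ i, π i ^ 2 := by
    have hc1 : ∀ p : Set.Icc 1 T × V,
        ((‖2 * B * π p.2 - -(2 * B * π p.2)‖ / 2) ^ 2 : ℝ) = (2 * B) ^ 2 * π p.2 ^ 2 := fun p => by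
      have := hπ p.2
      rw [Real.norm_of_nonneg (by nlinarith [mul_nonneg hB.le this])]; ring
    simp only [c, NNReal.coe_sum, NNReal.coe_pow, NNReal.coe_div, coe_nnnorm, NNReal.coe_ofNat, hc1]
    rw [hFsum fun _ i => (2 * B) ^ 2 * π i ^ 2]
    simp only [Finset.sum_const, Nat.card_Icc, Nat.add_sub_cancel, nsmul_eq_mul, ← Finset.mul_sum]
    ring
  have hQ1 : ∑ i, π i ^ 2 ≤ 1 := by
    rw [← hπ1]
    refine Finset.sum_le_sum fun i _ => ?_
    have h1 : π i ≤ 1 := by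
      rw [← hπ1]; exact Finset.single_le_sum (fun i _ => hπ i) (Finset.mem_univ i)
    nlinarith [hπ i]
  have hQ0 : 0 < ∑ i, π i ^ 2 := by
    by_contra hneg
    have h0 := (Finset.sum_eq_zero_iff_of_nonneg fun i _ => sq_nonneg (π i)).1
      (le_antisymm (not_lt.1 hneg) (Finset.sum_nonneg fun i _ => sq_nonneg (π i)))
    have : ∑ i, π i = 0 := Finset.sum_eq_zero fun i hi => pow_eq_zero_iff (two_ne_zero) |>.1 (h0 i hi)
    linarith
  refine (measure_mono hset).trans ?_
  rw [← ofReal_measureReal]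
  refine ENNReal.ofReal_le_ofReal (hH.trans (Real.exp_le_exp.2 ?_))
  rw [hc, neg_div, neg_le_neg_iff, div_le_div_iff₀ (by positivity) (by positivity)]
  have : (t * ι ^ 2) * (2 * (4 * B ^ 2 * t)) * ∑ i, π i ^ 2 ≤ (t * ι ^ 2) * (2 * (4 * B ^ 2 * t)) * 1 :=
    mul_le_mul_of_nonneg_left hQ1 (by positivity)
  linarith

end SignalModel

/-! ### Mixing of the communication matrix -/

/-- Indexing by the age `s` of the signals, rather than by their round, matches `agentPhi_eq_sum`
term by term. -/
lemma centralPhi_eq_sum_range {V : Type} [Fintype V] {m : ℕ} (π : V → ℝ) (ψ : ℕ → V → Fin m → ℝ) (t : ℕ) (k : Fin m) :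
    centralPhi π ψ t k = ∑ s ∈ Finset.range t, ∑ j, π j * ψ (t - s) j k := by
  induction t with
  | zero => simp [centralPhi]
  | succ t ih =>
    rw [Finset.sum_range_succ']
    simp only [Nat.add_sub_add_right, ← ih]
    rfl

section Mixing

variable {V : Type} [Fintype V] [DecidableEq V]

/-- The `ℓ¹` distances of the rows of `W ^ s` to `ρ` have sum over `s` at most `S`. -/
def MixesWithin (W : Matrix V V ℝ) (ρ : V → ℝ) (S : ℝ) : Prop :=
  ∀ i t, ∑ s ∈ Finset.range t, ∑ j, |(W ^ s) i j - ρ j| ≤ S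

lemma agentPhi_eq_sum {m : ℕ} (W : Matrix V V ℝ) (ψ : ℕ → V → Fin m → ℝ) (t : ℕ) (i : V)
    (k : Fin m) :
    agentPhi W ψ t i k = ∑ s ∈ Finset.range t, ∑ j, (W ^ s) i j * ψ (t - s) j k := by
  induction t generalizing i with
  | zero => simp [agentPhi]
  | succ t ih =>
    rw [Finset.sum_range_succ']
    change ∑ j, W i j * agentPhi W ψ t j k + ψ (t + 1) i k = _
    congr 1
    · simp only [ih, Finset.mul_sum, pow_succ', Matrix.mul_apply, Finset.sum_mul,
        Nat.add_sub_add_right]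
      rw [Finset.sum_comm]
      refine Finset.sum_congr rfl fun s _ => ?_
      rw [Finset.sum_comm]
      exact Finset.sum_congr rfl fun j _ => Finset.sum_congr rfl fun l _ => (mul_assoc _ _ _).symm
    · simp [Matrix.one_apply]

lemma abs_agentPhi_sub_centralPhi_le {m : ℕ} {W : Matrix V V ℝ} {π : V → ℝ} {S B : ℝ}
    (hB : 0 ≤ B) (hW : MixesWithin W π S) {ψ : ℕ → V → Fin m → ℝ} (hψ : ∀ t i k, |ψ t i k| ≤ B)
    (t : ℕ) (i : V) (k : Fin m) :
    |agentPhi W ψ t i k - centralPhi π ψ t k| ≤ B * S := by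
  rw [agentPhi_eq_sum, centralPhi_eq_sum_range, ← Finset.sum_sub_distrib]
  simp only [← Finset.sum_sub_distrib, ← sub_mul]
  calc |∑ s ∈ Finset.range t, ∑ j, ((W ^ s) i j - π j) * ψ (t - s) j k|
      ≤ ∑ s ∈ Finset.range t, ∑ j, |((W ^ s) i j - π j) * ψ (t - s) j k| :=
        (Finset.abs_sum_le_sum_abs _ _).trans
          (Finset.sum_le_sum fun _ _ => Finset.abs_sum_le_sum_abs _ _)
    _ ≤ ∑ s ∈ Finset.range t, ∑ j, |(W ^ s) i j - π j| * B := by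
        gcongr with s _ j _
        rw [abs_mul]
        exact mul_le_mul_of_nonneg_left (hψ _ _ _) (abs_nonneg _)
    _ ≤ B * S := by
        simp only [← Finset.sum_mul]
        rw [mul_comm]
        exact mul_le_mul_of_nonneg_left (hW i t) hB

lemma IsCentrality.eq_sum_pow {W : Matrix V V ℝ} {π : V → ℝ} (hπ : IsCentrality W π) (s : ℕ)
    (j : V) : π j = ∑ i, π i * (W ^ s) i j := by
  induction s generalizing j with
  | zero => simp [Matrix.one_apply]
  | succ s ih =>
    simp only [pow_succ, Matrix.mul_apply, Finset.mul_sum]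
    rw [Finset.sum_comm, hπ.stationary]
    refine Finset.sum_congr rfl fun l _ => ?_
    rw [ih l, Finset.mul_sum]
    exact Finset.sum_congr rfl fun i _ => by ring

/-- Averaging the rows of `W ^ s` against `π` returns `π`, so `|π j - ρ j|` is at most the averaged
distance at every time `s`; a positive constant cannot have bounded partial sums. An arbitrary
centrality is thereby the explicit `ρ`. -/
lemma IsCentrality.eq_of_mixesWithin {W : Matrix V V ℝ} {π ρ : V → ℝ} {S : ℝ}
    (hπ : IsCentrality W π) (hW : MixesWithin W ρ S) : π = ρ := by
  funext j
  have hstep : ∀ s, |π j - ρ j| ≤ ∑ i, π i * |(W ^ s) i j - ρ j| := fun s => by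
    have e : π j - ρ j = ∑ i, π i * ((W ^ s) i j - ρ j) := by
      simp only [mul_sub, Finset.sum_sub_distrib, ← hπ.eq_sum_pow, ← Finset.sum_mul,
        hπ.sum_eq_one, one_mul]
    rw [e]
    refine (Finset.abs_sum_le_sum_abs _ _).trans_eq (Finset.sum_congr rfl fun i _ => ?_)
    rw [abs_mul, abs_of_nonneg (hπ.nonneg i)]
  have hbound : ∀ t : ℕ, t * |π j - ρ j| ≤ S := fun t => by
    calc t * |π j - ρ j| = ∑ _s ∈ Finset.range t, |π j - ρ j| := by simp
      _ ≤ ∑ s ∈ Finset.range t, ∑ i, π i * |(W ^ s) i j - ρ j| :=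
        Finset.sum_le_sum fun s _ => hstep s
      _ = ∑ i, π i * ∑ s ∈ Finset.range t, |(W ^ s) i j - ρ j| := by
        rw [Finset.sum_comm]; simp only [Finset.mul_sum]
      _ ≤ ∑ i, π i * S := by
        gcongr with i _
        · exact hπ.nonneg i
        · refine le_trans (Finset.sum_le_sum fun s _ => ?_) (hW i t)
          exact Finset.single_le_sum (f := fun j => |(W ^ s) i j - ρ j|)
            (fun _ _ => abs_nonneg _) (Finset.mem_univ j)
      _ = S := by rw [← Finset.sum_mul, hπ.sum_eq_one, one_mul]
  by_contra hne
  have hpos : 0 < |π j - ρ j| := abs_pos.2 (sub_ne_zero.2 hne)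
  obtain ⟨t, ht⟩ := exists_nat_gt (S / |π j - ρ j|)
  rw [div_lt_iff₀ hpos] at ht
  exact absurd (hbound t) (not_le.2 ht)

/-! ### The spectral gap -/

lemma mem_spectrum_iff_exists_eigenvector {A : Matrix V V ℂ} {z : ℂ} :
    z ∈ spectrum ℂ A ↔ ∃ v : V → ℂ, v ≠ 0 ∧ A.mulVec v = z • v := by
  rw [← Matrix.spectrum_toLin', ← Module.End.hasEigenvalue_iff_mem_spectrum]
  constructor
  · intro h
    obtain ⟨v, hv⟩ := h.exists_hasEigenvector
    exact ⟨v, hv.2, by simpa using hv.apply_eq_smul⟩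
  · rintro ⟨v, hv, h⟩
    exact Module.End.hasEigenvalue_of_hasEigenvector
      (Module.End.hasEigenvector_iff.2 ⟨Module.End.mem_eigenspace_iff.2 (by simpa using h), hv⟩)

lemma spectralGap_le_one (W : Matrix V V ℝ) : spectralGap W ≤ 1 := by
  have : 0 ≤ secondModulus W := Real.sSup_nonneg fun x ⟨z, _, _, hx⟩ => hx ▸ norm_nonneg z
  rw [spectralGap]; linarith

lemma spectralGap_le_of_eigenvector {W : Matrix V V ℝ} {z : ℂ} (hz : z ≠ 1) {v : V → ℂ}
    (hv : v ≠ 0) (h : (W.map ((↑) : ℝ → ℂ)).mulVec v = z • v) : spectralGap W ≤ 1 - ‖z‖ := by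
  -- Finiteness bounds the set above; on an unbounded set the real `sSup` would be the default value
  -- `0`.
  have hfin : {x : ℝ | ∃ z ∈ spectrum ℂ (W.map ((↑) : ℝ → ℂ)), z ≠ 1 ∧ x = ‖z‖}.Finite := by
    have hs : (spectrum ℂ (W.map ((↑) : ℝ → ℂ))).Finite := by
      rw [← Matrix.spectrum_toLin']
      exact Module.End.finite_spectrum _
    refine (hs.image norm).subset ?_
    rintro x ⟨z, hz, _, rfl⟩
    exact ⟨z, hz, rfl⟩
  have : ‖z‖ ≤ secondModulus W :=
    le_csSup hfin.bddAbove ⟨z, mem_spectrum_iff_exists_eigenvector.2 ⟨v, hv, h⟩, hz, rfl⟩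
  rw [spectralGap]; linarith

lemma le_one_sub_inv_of_geom_sum_le {x S : ℝ} (hx : 0 ≤ x)
    (h : ∀ t : ℕ, ∑ s ∈ Finset.range t, x ^ s ≤ S) : x ≤ 1 - 1 / S := by
  have hx1 : x < 1 := by
    by_contra hge
    obtain ⟨t, ht⟩ := exists_nat_gt S
    have : (t : ℝ) ≤ ∑ s ∈ Finset.range t, x ^ s := by
      calc (t : ℝ) = ∑ _s ∈ Finset.range t, (1 : ℝ) := by simp
        _ ≤ _ := Finset.sum_le_sum fun s _ => one_le_pow₀ (not_lt.1 hge)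
    linarith [h t]
  have h1 := Real.tsum_le_of_sum_range_le (fun s => pow_nonneg hx s) h
  rw [tsum_geometric_of_lt_one hx hx1] at h1
  have h2 : 0 < 1 - x := by linarith
  have : 1 / S ≤ 1 - x := by
    rw [one_div]
    exact inv_le_of_inv_le₀ h2 h1
  linarith

/-- An eigenvector `v` for `z ≠ 1` is orthogonal to `π`, so `z ^ s * v i` is the sum of `((W ^ s) i
j - π j) * v j`. At an index where `|v i|` is largest this bounds `|z| ^ s` by the `ℓ¹` distance,
and summing the geometric series gives `1 / (1 - |z|) ≤ S`. It is needed for `η > 0`. -/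
lemma IsCentrality.one_div_le_spectralGap {W : Matrix V V ℝ} {π : V → ℝ} {S : ℝ}
    (hπ : IsCentrality W π) (hW : MixesWithin W π S) (hS : 1 ≤ S) : 1 / S ≤ spectralGap W := by
  have hS0 : 0 < S := by linarith
  suffices h : secondModulus W ≤ 1 - 1 / S by rw [spectralGap]; linarith
  -- The set may be empty, with supremum `0`; this is where `1 ≤ S` enters.
  refine Real.sSup_le ?_ (by rw [sub_nonneg, div_le_one hS0]; exact hS)
  rintro _ ⟨z, hz, hz1, rfl⟩
  obtain ⟨v, hv, hzv⟩ := mem_spectrum_iff_exists_eigenvector.1 hz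
  have hpow : ∀ s i, ∑ j, ((W ^ s) i j : ℂ) * v j = z ^ s * v i := by
    intro s
    induction s with
    | zero => intro i; simp [Matrix.one_apply, apply_ite ((↑) : ℝ → ℂ)]
    | succ s ih =>
      intro i
      have hi := congrFun hzv i
      simp only [Matrix.mulVec, dotProduct, Matrix.map_apply, Pi.smul_apply, smul_eq_mul] at hi
      simp only [pow_succ', Matrix.mul_apply, Complex.ofReal_sum, Complex.ofReal_mul,
        Finset.sum_mul]
      rw [Finset.sum_comm]
      simp only [mul_assoc, ← Finset.mul_sum, ih]
      simp only [mul_left_comm _ (z ^ s), ← Finset.mul_sum, hi]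
  have horth : ∑ j, (π j : ℂ) * v j = 0 := by
    have e : ∑ j, (π j : ℂ) * v j = z * ∑ j, (π j : ℂ) * v j := by
      calc ∑ j, (π j : ℂ) * v j = ∑ j, ((∑ i, π i * (W ^ 1) i j : ℝ) : ℂ) * v j :=
            Finset.sum_congr rfl fun j _ => by rw [← hπ.eq_sum_pow]
        _ = ∑ i, (π i : ℂ) * ∑ j, ((W ^ 1) i j : ℂ) * v j := by
            simp only [Complex.ofReal_sum, Complex.ofReal_mul, Finset.sum_mul, Finset.mul_sum]
            rw [Finset.sum_comm]
            simp only [mul_assoc]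
        _ = _ := by
            simp only [hpow, Finset.mul_sum]
            exact Finset.sum_congr rfl fun j _ => by ring
    have : (1 - z) * ∑ j, (π j : ℂ) * v j = 0 := by rw [sub_mul, ← e]; ring
    exact (mul_eq_zero.1 this).resolve_left (sub_ne_zero.2 hz1.symm)
  obtain ⟨i₀, hi₀⟩ := Function.ne_iff.1 hv
  have : Nonempty V := ⟨i₀⟩
  obtain ⟨i, hi⟩ := Finite.exists_max fun i => ‖v i‖
  have hvi : 0 < ‖v i‖ := (norm_pos_iff.2 hi₀).trans_le (hi i₀)
  refine le_one_sub_inv_of_geom_sum_le (norm_nonneg z) fun t => ?_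
  refine (Finset.sum_le_sum fun s _ => ?_).trans (hW i t)
  have e : z ^ s * v i = ∑ j, (((W ^ s) i j - π j : ℝ) : ℂ) * v j := by
    simp only [Complex.ofReal_sub, sub_mul, Finset.sum_sub_distrib, hpow, horth, sub_zero]
  refine le_of_mul_le_mul_right ?_ hvi
  rw [← norm_pow, ← norm_mul, e, Finset.sum_mul]
  refine (norm_sum_le _ _).trans (Finset.sum_le_sum fun j _ => ?_)
  rw [norm_mul, Complex.norm_real, Real.norm_eq_abs]
  exact mul_le_mul_of_nonneg_left (hi j) (abs_nonneg _)

end Mixing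

/-! ### The decentralization cost of a mixing network -/

lemma sum_klVec_gibbs_le {m T : ℕ} (hT : 1 ≤ T) (θ : Fin m) {a b : ℕ → Fin m → ℝ} {d t₀ L : ℝ}
    (ht₀ : 0 ≤ t₀) (h : ∀ t k, |a t k - b t k| ≤ d)
    (ha : ∀ t ∈ Finset.Icc 1 T, t₀ ≤ t → ∀ k, k ≠ θ → a t k - a t θ ≤ -L)
    (hb : ∀ t ∈ Finset.Icc 1 T, t₀ ≤ t → ∀ k, k ≠ θ → b t k - b t θ ≤ -L)
    (hL : m * Real.exp (-L) ≤ 1 / T) :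
    ∑ t ∈ Finset.Icc 1 T, klVec (gibbs (a t)) (gibbs (b t)) ≤ 2 * d * t₀ + (1 + 2 * d) := by
  have hd : 0 ≤ d := (abs_nonneg _).trans (h 0 θ)
  have hT0 : (0 : ℝ) < T := by exact_mod_cast hT
  have hterm : ∀ t ∈ Finset.Icc 1 T, klVec (gibbs (a t)) (gibbs (b t)) ≤
      (if (t : ℝ) < t₀ then 2 * d else 0) + 1 / T * (1 + 2 * d) := by
    intro t ht
    split_ifs with htt
    · have := klVec_gibbs_le θ.pos (h t)
      have : 0 ≤ 1 / T * (1 + 2 * d) := by positivity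
      linarith
    · rw [zero_add]
      exact (klVec_gibbs_le_of_gap θ (h t) (ha t ht (not_lt.1 htt)) (hb t ht (not_lt.1 htt))).trans
        (mul_le_mul_of_nonneg_right hL (by linarith))
  refine (Finset.sum_le_sum hterm).trans ?_
  rw [Finset.sum_add_distrib, ← Finset.sum_filter, Finset.sum_const, Finset.sum_const]
  have hcard : (((Finset.Icc 1 T).filter fun t : ℕ => (t : ℝ) < t₀).card : ℝ) ≤ t₀ := by
    refine le_trans ?_ (Nat.floor_le ht₀)
    have hsub : ((Finset.Icc 1 T).filter fun t : ℕ => (t : ℝ) < t₀) ⊆ Finset.Icc 1 ⌊t₀⌋₊ := by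
      intro t ht
      rw [Finset.mem_filter, Finset.mem_Icc] at ht
      exact Finset.mem_Icc.2 ⟨ht.1.1, Nat.le_floor ht.2.le⟩
    exact_mod_cast (Finset.card_le_card hsub).trans (by simp)
  simp only [nsmul_eq_mul, Nat.card_Icc, Nat.add_sub_cancel]
  have e : (T : ℝ) * (1 / T * (1 + 2 * d)) = 1 + 2 * d := by field_simp
  rw [e]
  nlinarith

/-- The constant in the bound for the decentralization cost. -/
noncomputable def costConst (B ι K : ℝ) : ℝ := 4 * B ^ 2 * K / ι ^ 2 + K ^ 2 * B / ι + 8 * B * K / ι + 1 + K / 8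

lemma costConst_pos {B ι K : ℝ} (hB : 0 < B) (hι : 0 < ι) (hK : 0 < K) : 0 < costConst B ι K := by
  unfold costConst; positivity

/-- Here `g` is the true spectral gap, which sets `η`, and `γ` the denominator in the claim. They
are kept apart because on odd cycles `2 ω - 1` is not an eigenvalue, and `g` can exceed `γ`. The
first burn-in term uses `S ≤ K / γ`, the second uses `η B S ≤ K / 16` as well, and in the third `η`
cancels. -/
lemma cost_budget_le {B ι K S g γ η Λ l : ℝ} (hB : 0 < B) (hι : 0 < ι) (hS : 1 ≤ S)
    (hg0 : 0 < g) (hg1 : g ≤ 1) (hK : S * g ≤ K) (hγ0 : 0 < γ) (hγ1 : γ ≤ 1) (hKγ : S * γ ≤ K)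
    (hΛ : 1 ≤ Λ) (hl : 1 ≤ l) (hη : η = g / (16 * B * l)) :
    2 * (η * (B * S)) * (32 * B ^ 2 * Λ / ι ^ 2 + 8 * B * S / ι + 4 * Λ / (η * ι)) +
      (1 + 2 * (η * (B * S))) ≤ costConst B ι K * (Λ / γ) := by
  have hK0 : 0 < K := lt_of_lt_of_le (by positivity) hK
  have hη0 : 0 < η := by rw [hη]; positivity
  have hηB : η * B ≤ g / 16 := by
    rw [hη, div_mul_eq_mul_div, div_le_div_iff₀ (by positivity) (by norm_num)]
    nlinarith [mul_le_mul_of_nonneg_left hl (by positivity : 0 ≤ g * B)]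
  have hd : η * (B * S) ≤ K / 16 := by nlinarith
  have hSK : S ≤ K / γ := by rwa [le_div_iff₀ hγ0]
  have hd' : η * (B * S) ≤ K / γ / 16 := by nlinarith
  have hγΛ : 1 ≤ Λ / γ := by rw [le_div_iff₀ hγ0]; linarith
  have hγi : 1 / γ ≤ Λ / γ := by gcongr
  have h1 : 2 * (η * (B * S)) * (32 * B ^ 2 * Λ / ι ^ 2) ≤ 4 * B ^ 2 * K / ι ^ 2 * (Λ / γ) := by
    calc 2 * (η * (B * S)) * (32 * B ^ 2 * Λ / ι ^ 2)
        ≤ 2 * (K / γ / 16) * (32 * B ^ 2 * Λ / ι ^ 2) := by gcongr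
      _ = _ := by field_simp; ring
  have h2 : 2 * (η * (B * S)) * (8 * B * S / ι) ≤ K ^ 2 * B / ι * (Λ / γ) := by
    calc 2 * (η * (B * S)) * (8 * B * S / ι) ≤ 2 * (K / 16) * (8 * B * (K / γ) / ι) := by gcongr
      _ = K ^ 2 * B / ι * (1 / γ) := by field_simp; ring
      _ ≤ _ := by gcongr
  have h3 : 2 * (η * (B * S)) * (4 * Λ / (η * ι)) ≤ 8 * B * K / ι * (Λ / γ) := by
    calc 2 * (η * (B * S)) * (4 * Λ / (η * ι)) = 8 * B * S * Λ / ι := by field_simp; ring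
      _ ≤ 8 * B * (K / γ) * Λ / ι := by gcongr
      _ = _ := by field_simp
  have h4 : 1 + 2 * (η * (B * S)) ≤ (1 + K / 8) * (Λ / γ) := by
    calc 1 + 2 * (η * (B * S)) ≤ (1 + K / 8) * 1 := by linarith
      _ ≤ _ := by gcongr
  unfold costConst
  nlinarith

/-- A union bound over at most `T * m` pairs; the threshold on `t` is the point where the exponent
`t ι² / (32 B²)` reaches `Λ`. -/
lemma SignalModel.IsSignalSequence.measure_not_gap_le {V : Type} [Fintype V] {m T : ℕ}
    {M : SignalModel.{u} V m} {Ω : Type v} [MeasurableSpace Ω] {P : Measure Ω}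
    [IsProbabilityMeasure P] {s : ℕ → ∀ i, Ω → M.S i} {θ : Fin m} {B ι Λ : ℝ} (hB : 0 < B)
    (hι : 0 < ι) (hM : M.LogBounded B) (hs : M.IsSignalSequence θ T P s) {π : V → ℝ}
    (hπ : ∀ i, 0 ≤ π i) (hπ1 : ∑ i, π i = 1) (hinfo : ∀ k, k ≠ θ → ι ≤ M.info π θ k) :
    P {ω | ∃ t ∈ Finset.Icc 1 T, 32 * B ^ 2 * Λ / ι ^ 2 ≤ t ∧ ∃ k, k ≠ θ ∧
      -(t * ι / 2) ≤ centralPhi π (M.logLik fun t i => s t i ω) t k -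
        centralPhi π (M.logLik fun t i => s t i ω) t θ} ≤
      ENNReal.ofReal (T * m * Real.exp (-Λ)) := by
  let bad : ℕ → Fin m → Set Ω := fun t k => {ω | 32 * B ^ 2 * Λ / ι ^ 2 ≤ t ∧ k ≠ θ ∧
    -(t * ι / 2) ≤ centralPhi π (M.logLik fun t i => s t i ω) t k -
      centralPhi π (M.logLik fun t i => s t i ω) t θ}
  have hbad : ∀ t ∈ Finset.Icc 1 T, ∀ k, P (bad t k) ≤ ENNReal.ofReal (Real.exp (-Λ)) := by
    intro t ht k
    rw [Finset.mem_Icc] at ht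
    by_cases h : 32 * B ^ 2 * Λ / ι ^ 2 ≤ t ∧ k ≠ θ
    · refine (measure_mono fun ω hω => hω.2.2).trans
        ((hs.measure_centralPhi_sub_ge_le hB hM hπ hπ1 hι
          (hinfo k h.2) ht.1 ht.2).trans (ENNReal.ofReal_le_ofReal ?_))
      rw [Real.exp_le_exp, neg_le_neg_iff, le_div_iff₀ (by positivity)]
      have h1 := h.1
      rw [div_le_iff₀ (by positivity)] at h1
      linarith
    · have : bad t k = ∅ := Set.eq_empty_of_forall_notMem fun ω hω => h ⟨hω.1, hω.2.1⟩
      rw [this, measure_empty]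
      exact zero_le
  refine (measure_mono
    (t := ⋃ t ∈ Finset.Icc 1 T, ⋃ k ∈ (Finset.univ : Finset (Fin m)), bad t k) ?_).trans ?_
  · rintro ω ⟨t, ht, htt, k, hk, h⟩
    exact Set.mem_iUnion₂.2 ⟨t, ht, Set.mem_iUnion₂.2 ⟨k, Finset.mem_univ k, htt, hk, h⟩⟩
  calc P (⋃ t ∈ Finset.Icc 1 T, ⋃ k ∈ (Finset.univ : Finset (Fin m)), bad t k)
      ≤ ∑ t ∈ Finset.Icc 1 T, ∑ k, P (bad t k) :=
        (measure_biUnion_finset_le _ _).trans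
          (Finset.sum_le_sum fun t _ => measure_biUnion_finset_le _ _)
    _ ≤ ∑ t ∈ Finset.Icc 1 T, ∑ _k : Fin m, ENNReal.ofReal (Real.exp (-Λ)) :=
        Finset.sum_le_sum fun t ht => Finset.sum_le_sum fun k _ => hbad t ht k
    _ = _ := by
        simp only [Finset.sum_const, Finset.card_univ, Fintype.card_fin, Nat.card_Icc,
          Nat.add_sub_cancel, nsmul_eq_mul]
        rw [← ENNReal.ofReal_natCast, ← ENNReal.ofReal_natCast,
          ← ENNReal.ofReal_mul (by positivity), ← ENNReal.ofReal_mul (by positivity), mul_assoc]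

/-- In a network with mixing sum `S`, comparable to the inverse spectral gap and at most of order
`1 / γ`, the decentralization cost is of order `log (n m T) / γ` with high probability. -/
theorem costBound_of_mixesWithin {V : Type} [Fintype V] [DecidableEq V] {W : Matrix V V ℝ}
    {ρ : V → ℝ} {S γ K B ι δ : ℝ} (hB : 0 < B) (hι : 0 < ι) (hδ : 0 < δ)
    (hmix : MixesWithin W ρ S) (hS : 1 ≤ S) (hK : S * spectralGap W ≤ K) (hγ0 : 0 < γ)
    (hγ1 : γ ≤ 1) (hKγ : S * γ ≤ K) (hcard : 3 ≤ Fintype.card V)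
    (hδV : 1 / δ ≤ Fintype.card V) :
    CostBound.{u, v} W B ι δ fun m T =>
      costConst B ι K * (Real.log (Fintype.card V * m * T) / γ) := by
  intro m T hm hT M θ hM _ π hπ hinfo Ω _ P _ s hs η hη i μA μC hA hC
  obtain rfl := hπ.eq_of_mixesWithin hmix
  have hg0 : 0 < spectralGap W :=
    lt_of_lt_of_le (by positivity) (hπ.one_div_le_spectralGap hmix hS)
  have hn3 : (3 : ℝ) ≤ Fintype.card V := by exact_mod_cast hcard
  set n : ℝ := (Fintype.card V : ℝ) with hn
  have hm1 : (1 : ℝ) ≤ m := by exact_mod_cast (by omega : 1 ≤ m)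
  have hT1 : (1 : ℝ) ≤ T := by exact_mod_cast hT
  have hmT : 1 ≤ (m : ℝ) * T := one_le_mul_of_one_le_of_one_le hm1 hT1
  have hl : 1 ≤ Real.log n := by
    rw [Real.le_log_iff_exp_le (by linarith)]
    linarith [Real.exp_one_lt_d9]
  set Λ := Real.log (n * m * T) with hΛdef
  have hnmT : 0 < n * m * T := by positivity
  have hΛ : 1 ≤ Λ := hl.trans <| Real.log_le_log (by linarith) <| by
    rw [mul_assoc]; exact le_mul_of_one_le_right (by linarith) hmT
  have hexp : Real.exp (-Λ) = 1 / (n * m * T) := by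
    rw [Real.exp_neg, hΛdef, Real.exp_log hnmT, one_div]
  have hη0 : 0 < η := by rw [hη]; positivity
  set t₁ := 32 * B ^ 2 * Λ / ι ^ 2 with ht₁
  -- The first term makes the concentration bound effective. The second ensures `2 B S ≤ t ι / 4`,
  -- so the deviation of the agent uses up at most half of the drift `t ι / 2`. The third ensures
  -- that `η` times the remaining `t ι / 4` is at least `Λ`.
  set t₀ := t₁ + 8 * B * S / ι + 4 * Λ / (η * ι) with ht₀
  have ht₁0 : 0 ≤ t₁ := by positivity
  have hs2 : 0 ≤ 8 * B * S / ι := by positivity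
  have hs3 : 0 ≤ 4 * Λ / (η * ι) := by positivity
  let ψ : Ω → ℕ → V → Fin m → ℝ := fun ω => M.logLik fun t i => s t i ω
  have hψ : ∀ ω t i k, |ψ ω t i k| ≤ B := fun ω t i k => (hM i k (s t i ω)).2
  let bads : Set Ω := {ω | ∃ t ∈ Finset.Icc 1 T, t₁ ≤ t ∧ ∃ k, k ≠ θ ∧
    -(t * ι / 2) ≤ centralPhi π (ψ ω) t k - centralPhi π (ψ ω) t θ}
  have hbads : P bads ≤ ENNReal.ofReal δ := by
    refine (hs.measure_not_gap_le hB hι hM hπ.nonneg hπ.sum_eq_one hinfo).trans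
      (ENNReal.ofReal_le_ofReal ?_)
    have e : (T : ℝ) * m * Real.exp (-Λ) = 1 / n := by rw [hexp]; field_simp
    rw [div_le_iff₀ hδ] at hδV
    rw [e, div_le_iff₀ (by linarith)]
    linarith
  have hgood : badsᶜ ⊆ {ω | decentralizationCost T (μA ω) (μC ω) ≤
      costConst B ι K * (Λ / γ)} := by
    intro ω hω
    have hω' : ∀ t ∈ Finset.Icc 1 T, t₁ ≤ t → ∀ k, k ≠ θ →
        centralPhi π (ψ ω) t k - centralPhi π (ψ ω) t θ ≤ -(t * ι / 2) := by
      intro t ht htt k hk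
      by_contra hlt
      exact hω ⟨t, ht, htt, k, hk, (not_le.1 hlt).le⟩
    have hdev := abs_agentPhi_sub_centralPhi_le hB.le hmix (hψ ω)
    have hcost : decentralizationCost T (μA ω) (μC ω) = ∑ t ∈ Finset.Icc 1 T,
        klVec (gibbs fun k => η * agentPhi W (ψ ω) t i k)
          (gibbs fun k => η * centralPhi π (ψ ω) t k) :=
      Finset.sum_congr rfl fun t ht => by
        rw [(hA ω t ht).eq_gibbs hη0 (by omega), (hC ω t ht).eq_gibbs hη0 (by omega)]
    have hkey : ∀ t : ℕ, t₀ ≤ t → Λ ≤ η * (t * ι / 4) ∧ 2 * (B * S) ≤ t * ι / 4 := by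
      intro t ht
      have h2 : 8 * B * S / ι ≤ t := by linarith
      have h3 : 4 * Λ / (η * ι) ≤ t := by linarith
      rw [div_le_iff₀ (by positivity)] at h2 h3
      constructor <;> linarith
    rw [Set.mem_ofPred_eq, hcost]
    refine (sum_klVec_gibbs_le hT θ (d := η * (B * S)) (t₀ := t₀) (L := Λ) (by positivity)
      ?_ ?_ ?_ ?_).trans
      (cost_budget_le hB hι hS hg0 (spectralGap_le_one W) hK hγ0 hγ1 hKγ hΛ hl hη)
    · intro t k
      rw [← mul_sub, abs_mul, abs_of_pos hη0]
      exact mul_le_mul_of_nonneg_left (hdev t i k) hη0.le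
    · intro t ht htt k hk
      have h1 := hω' t ht (by linarith) k hk
      have h2 := abs_le.1 (hdev t i k)
      have h3 := abs_le.1 (hdev t i θ)
      obtain ⟨h4, h5⟩ := hkey t htt
      have : agentPhi W (ψ ω) t i k - agentPhi W (ψ ω) t i θ ≤ -(t * ι / 4) := by linarith
      have := mul_le_mul_of_nonneg_left this hη0.le
      linarith
    · intro t ht htt k hk
      have h1 := hω' t ht (by linarith) k hk
      obtain ⟨h4, h5⟩ := hkey t htt
      have : centralPhi π (ψ ω) t k - centralPhi π (ψ ω) t θ ≤ -(t * ι / 4) := by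
        have : 0 ≤ (t : ℝ) * ι := by positivity
        linarith
      have := mul_le_mul_of_nonneg_left this hη0.le
      linarith
    · rw [hexp, mul_one_div, div_le_div_iff₀ hnmT (by linarith)]
      have := mul_le_mul_of_nonneg_right (by linarith : 1 ≤ n) (by positivity : 0 ≤ (m : ℝ) * T)
      linarith
  -- Subadditivity alone is used, so that `bads` need not be measurable.
  have hone : (1 : ENNReal) ≤ P badsᶜ + ENNReal.ofReal δ := by
    calc (1 : ENNReal) = P (badsᶜ ∪ bads) := by rw [Set.compl_union_self, measure_univ]
      _ ≤ P badsᶜ + P bads := measure_union_le _ _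
      _ ≤ _ := by gcongr
  refine le_trans ?_ (measure_mono hgood)
  rw [ENNReal.ofReal_sub _ hδ.le, ENNReal.ofReal_one]
  exact tsub_le_iff_right.2 hone

/-! ### Mixing and spectral gap from a resolution of the identity by eigenmatrices -/

section Resolution

variable {V : Type} [Fintype V] [DecidableEq V] {κ : Type} {W : Matrix V V ℝ}

/-- Applying `W` repeatedly to the resolution of the identity gives `W ^ s` as `ρ` plus the sum of
`l a ^ s * E a`, and the geometric series are summed. The columns of `E a` only have to be
eigenvectors; idempotence plays no role. -/
lemma mixesWithin_of_resolution {ρ : V → ℝ} {I : Finset κ} {E : κ → V → V → ℂ} {l c : κ → ℝ}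
    (hrow : ∀ i, ∑ j, W i j = 1)
    (hE : ∀ a ∈ I, ∀ i j, ∑ r, (W i r : ℂ) * E a r j = l a * E a i j)
    (hone : ∀ i j, (ρ j : ℂ) + ∑ a ∈ I, E a i j = if i = j then 1 else 0)
    (hl : ∀ a ∈ I, |l a| < 1) (hc : ∀ a ∈ I, ∀ i, ∑ j, ‖E a i j‖ ≤ c a) :
    MixesWithin W ρ (∑ a ∈ I, c a * (1 / (1 - |l a|))) := by
  have hpow : ∀ s i j, ((W ^ s) i j : ℂ) = ρ j + ∑ a ∈ I, (l a : ℂ) ^ s * E a i j := by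
    intro s
    induction s with
    | zero =>
      intro i j
      simp only [pow_zero, one_mul, hone, Matrix.one_apply]
      split_ifs <;> simp
    | succ s ih =>
      intro i j
      simp only [pow_succ', Matrix.mul_apply, Complex.ofReal_sum, Complex.ofReal_mul, ih, mul_add,
        Finset.sum_add_distrib, ← Finset.sum_mul, Finset.mul_sum]
      congr 1
      · rw [← Complex.ofReal_sum, hrow, Complex.ofReal_one, one_mul]
      · rw [Finset.sum_comm]
        refine Finset.sum_congr rfl fun a ha => ?_
        simp only [mul_left_comm _ ((l a : ℂ) ^ s), ← Finset.mul_sum, hE a ha]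
        ring
  intro i t
  have hstep : ∀ s, ∑ j, |(W ^ s) i j - ρ j| ≤ ∑ a ∈ I, c a * |l a| ^ s := by
    intro s
    calc ∑ j, |(W ^ s) i j - ρ j| ≤ ∑ j, ∑ a ∈ I, |l a| ^ s * ‖E a i j‖ := by
          refine Finset.sum_le_sum fun j _ => ?_
          rw [← Real.norm_eq_abs, ← Complex.norm_real, Complex.ofReal_sub, hpow, add_sub_cancel_left]
          refine (norm_sum_le _ _).trans_eq (Finset.sum_congr rfl fun a _ => ?_)
          rw [norm_mul, norm_pow, Complex.norm_real, Real.norm_eq_abs]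
      _ = ∑ a ∈ I, |l a| ^ s * ∑ j, ‖E a i j‖ := by
          rw [Finset.sum_comm]; simp only [Finset.mul_sum]
      _ ≤ _ := Finset.sum_le_sum fun a ha => by
          rw [mul_comm]
          exact mul_le_mul_of_nonneg_right (hc a ha i) (pow_nonneg (abs_nonneg _) _)
  refine (Finset.sum_le_sum fun s _ => hstep s).trans ?_
  rw [Finset.sum_comm]
  refine Finset.sum_le_sum fun a ha => ?_
  rw [← Finset.mul_sum]
  refine mul_le_mul_of_nonneg_left ?_
    ((Finset.sum_nonneg fun j _ => norm_nonneg (E a i j)).trans (hc a ha i))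
  rw [one_div, ← tsum_geometric_of_lt_one (abs_nonneg _) (hl a ha)]
  exact (summable_geometric_of_lt_one (abs_nonneg _) (hl a ha)).sum_le_tsum _
    fun _ _ => pow_nonneg (abs_nonneg _) _

lemma spectralGap_le_of_real_eigenvector {l : ℝ} (hl : l ≠ 1) {f : V → ℂ} (hf : f ≠ 0)
    (h : ∀ i, ∑ r, (W i r : ℂ) * f r = l * f i) : spectralGap W ≤ 1 - |l| := by
  rw [← Real.norm_eq_abs, ← Complex.norm_real]
  exact spectralGap_le_of_eigenvector (by exact_mod_cast hl) hf (funext h)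

end Resolution

/-! ### Entries of the communication matrix -/

section Entries

variable {V : Type} [Fintype V] {G : SimpleGraph V} {ω : ℝ} {i j : V}

lemma commMatrix_apply_self (i : V) : commMatrix G ω i i = ω := by simp [commMatrix]

lemma commMatrix_apply_of_adj [Fintype (G.neighborSet i)] (h : G.Adj i j) :
    commMatrix G ω i j = (1 - ω) / G.degree i := by
  simp only [commMatrix, Matrix.of_apply, if_neg h.ne, if_pos h]
  congr!

lemma commMatrix_apply_of_not_adj (hij : i ≠ j) (h : ¬G.Adj i j) : commMatrix G ω i j = 0 := by
  simp [commMatrix, hij, h]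

end Entries

/-! ### The star -/

section Star

variable {n : ℕ} (c : Fin n) (ω : ℝ)

lemma sum_commMatrix_star_center (hn : 2 ≤ n) (f : Fin n → ℝ) :
    ∑ j, commMatrix (SimpleGraph.starGraph c) ω c j * f j =
      ω * f c + (1 - ω) / (n - 1) * ∑ j ∈ Finset.univ.erase c, f j := by
  classical
  rw [← Finset.add_sum_erase _ _ (Finset.mem_univ c), Finset.mul_sum]
  congr 1
  · simp [commMatrix]
  · refine Finset.sum_congr rfl fun j hj => ?_
    have hj := Finset.ne_of_mem_erase hj
    rw [commMatrix_apply_of_adj (SimpleGraph.starGraph_center_adj hj.symm),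
      SimpleGraph.degree_starGraph_center, Fintype.card_fin, Nat.cast_sub (by omega), Nat.cast_one]

lemma sum_commMatrix_star_leaf {i : Fin n} (hi : i ≠ c) (f : Fin n → ℝ) :
    ∑ j, commMatrix (SimpleGraph.starGraph c) ω i j * f j = ω * f i + (1 - ω) * f c := by
  classical
  have hentry : ∀ j, commMatrix (SimpleGraph.starGraph c) ω i j * f j =
      (if j = i then ω * f i else 0) + if j = c then (1 - ω) * f c else 0 := by
    intro j
    rcases eq_or_ne j i with rfl | hj
    · simp [hi, commMatrix_apply_self]
    · rcases eq_or_ne j c with rfl | hjc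
      · rw [commMatrix_apply_of_adj (SimpleGraph.starGraph_center_adj' hj),
          SimpleGraph.degree_starGraph_of_ne_center hi]
        simp [hj]
      · rw [commMatrix_apply_of_not_adj hj.symm (by simp [SimpleGraph.starGraph_adj, hi, hjc])]
        simp [hj, hjc]
  simp only [hentry, Finset.sum_add_distrib, Finset.sum_ite_eq', Finset.mem_univ, if_true]

/-- The stationary distribution of a star. -/
noncomputable def starCentrality (j : Fin n) : ℝ := if j = c then 1 / 2 else 1 / (2 * (n - 1))

/-- The sign that tells the centre of a star from its leaves. -/
def starSign (j : Fin n) : ℝ := if j = c then 1 else -1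

/-- The projections onto the nontrivial eigenspaces of a star, those of `2 ω - 1` and of `ω`. -/
noncomputable def starProj : Bool → Fin n → Fin n → ℝ
  | false, i, j => starCentrality c j * (starSign c i * starSign c j)
  | true, i, j => if i = c ∨ j = c then 0 else (if i = j then 1 else 0) - 1 / (n - 1)

/-- The nontrivial eigenvalues of a star. -/
def starEigenvalue : Bool → ℝ
  | false => 2 * ω - 1
  | true => ω

lemma sum_erase_const (a : ℝ) : ∑ _j ∈ Finset.univ.erase c, a = (n - 1) * a := by
  rw [Finset.sum_const, Finset.card_erase_of_mem (Finset.mem_univ c), Finset.card_univ,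
    Fintype.card_fin, nsmul_eq_mul, Nat.cast_sub c.pos, Nat.cast_one]

lemma starProj_eigen (hn : 2 ≤ n) (a : Bool) (i j : Fin n) :
    ∑ r, commMatrix (SimpleGraph.starGraph c) ω i r * starProj c a r j =
      starEigenvalue ω a * starProj c a i j := by
  have hn' : (n : ℝ) - 1 ≠ 0 := by
    have : (2 : ℝ) ≤ n := by exact_mod_cast hn
    linarith
  rcases eq_or_ne i c with rfl | hi
  · rw [sum_commMatrix_star_center _ _ hn]
    cases a
    · have h : ∀ r ∈ Finset.univ.erase i, starProj i false r j = -starCentrality i j * starSign i j :=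
        fun r hr => by simp [starProj, starSign, Finset.ne_of_mem_erase hr]
      rw [Finset.sum_congr rfl h, sum_erase_const]
      simp only [starProj, starEigenvalue, starSign, if_true]
      field_simp
      ring
    · have h : ∑ r ∈ Finset.univ.erase i, starProj i true r j = 0 := by
        rcases eq_or_ne j i with rfl | hj
        · exact Finset.sum_eq_zero fun r _ => by simp [starProj]
        · rw [Finset.sum_congr rfl (g := fun r => (if r = j then 1 else 0) - 1 / ((n : ℝ) - 1))
            fun r hr => by simp [starProj, hj, Finset.ne_of_mem_erase hr]]
          rw [Finset.sum_sub_distrib, sum_erase_const, Finset.sum_ite_eq',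
            if_pos (Finset.mem_erase.2 ⟨hj, Finset.mem_univ j⟩)]
          field_simp
          ring
      rw [h]
      simp [starProj]
  · rw [sum_commMatrix_star_leaf _ _ hi]
    cases a
    · simp only [starProj, starEigenvalue, starSign, if_true, if_neg hi]; ring
    · simp [starProj, starEigenvalue]

lemma sum_starCentrality (hn : 2 ≤ n) : ∑ j, starCentrality c j = 1 := by
  have hn' : (n : ℝ) - 1 ≠ 0 := by
    have : (2 : ℝ) ≤ n := by exact_mod_cast hn
    linarith
  rw [← Finset.add_sum_erase _ _ (Finset.mem_univ c),
    Finset.sum_congr rfl (g := fun _ => 1 / (2 * ((n : ℝ) - 1)))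
      fun r hr => by simp [starCentrality, Finset.ne_of_mem_erase hr], sum_erase_const]
  simp only [starCentrality, if_true]
  field_simp
  norm_num

/-- The large multiplicity of the eigenvalue `ω` is harmless: its whole projection has rows of `ℓ¹`
norm at most `2`. The rows of the sign projection have absolute values `starCentrality`, hence norm
`1`. -/
lemma mixesWithin_star (hn : 2 ≤ n) (h0 : 0 < ω) (h1 : ω < 1) :
    MixesWithin (commMatrix (SimpleGraph.starGraph c) ω) (starCentrality c)
      (1 / (1 - |2 * ω - 1|) + 2 * (1 / (1 - ω))) := by
  have hn1 : (0 : ℝ) < n - 1 := by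
    have : (2 : ℝ) ≤ n := by exact_mod_cast hn
    linarith
  have h := mixesWithin_of_resolution (W := commMatrix (SimpleGraph.starGraph c) ω)
    (ρ := starCentrality c) (I := Finset.univ) (E := fun a i j => ((starProj c a i j : ℝ) : ℂ))
    (l := starEigenvalue ω) (c := fun a => if a then 2 else 1) ?_ ?_ ?_ ?_ ?_
  · convert h using 1
    simp [starEigenvalue, abs_of_pos h0, add_comm]
  · intro i
    rcases eq_or_ne i c with rfl | hi
    · have := sum_commMatrix_star_center i ω hn fun _ => 1
      rw [sum_erase_const] at this
      simp only [mul_one] at this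
      rw [this]; field_simp; ring
    · have := sum_commMatrix_star_leaf c ω hi fun _ => 1
      simp only [mul_one] at this
      rw [this]; ring
  · intro a _ i j
    exact_mod_cast starProj_eigen c ω hn a i j
  · intro i j
    have : starCentrality c j + ∑ a, starProj c a i j = if i = j then 1 else 0 := by
      simp only [Fintype.sum_bool, starProj, starCentrality, starSign]
      rcases eq_or_ne i c with rfl | hi
      · rcases eq_or_ne j i with rfl | hj
        · simp; norm_num
        · simp [hj, hj.symm]
      · rcases eq_or_ne j c with rfl | hj
        · simp [hi]
        · simp only [hi, hj, if_false, or_self]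
          split_ifs <;> field_simp <;> ring
    rw [← Complex.ofReal_sum, ← Complex.ofReal_add, this]
    split_ifs <;> simp
  · intro a _
    cases a
    · simp only [starEigenvalue]; rw [abs_lt]; constructor <;> linarith
    · simp only [starEigenvalue]; rw [abs_lt]; constructor <;> linarith
  · intro a _ i
    simp only [Complex.norm_real, Real.norm_eq_abs]
    cases a
    · refine le_of_eq ?_
      rw [if_neg (by simp), ← sum_starCentrality c hn]
      refine Finset.sum_congr rfl fun j _ => ?_
      have hs : ∀ r, |starSign c r| = 1 := fun r => by unfold starSign; split_ifs <;> simp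
      have hc : 0 ≤ starCentrality c j := by unfold starCentrality; split_ifs <;> positivity
      simp only [starProj]
      rw [abs_mul, abs_mul, hs, hs, mul_one, mul_one, abs_of_nonneg hc]
    · rw [if_pos rfl]
      rw [← Finset.add_sum_erase _ _ (Finset.mem_univ c)]
      have hb : ∀ j ∈ Finset.univ.erase c, |starProj c true i j| ≤
          (if i = j then 1 else 0) + 1 / ((n : ℝ) - 1) := by
        intro j _
        have : (0 : ℝ) ≤ 1 / ((n : ℝ) - 1) := by positivity
        simp only [starProj]
        split_ifs <;> first | (rw [abs_zero]; linarith) | (rw [abs_le]; constructor <;> linarith)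
      refine (add_le_add_right (Finset.sum_le_sum hb) _).trans ?_
      rw [Finset.sum_add_distrib, sum_erase_const, Finset.sum_ite_eq]
      have : ((n : ℝ) - 1) * (1 / (n - 1)) = 1 := by field_simp
      rw [this]
      simp only [starProj, or_true, if_true, abs_zero]
      split_ifs <;> norm_num

lemma spectralGap_star_le (hn : 3 ≤ n) (h0 : 0 < ω) (h1 : ω < 1) :
    spectralGap (commMatrix (SimpleGraph.starGraph c) ω) ≤ min (1 - ω) (1 - |2 * ω - 1|) := by
  have key : ∀ a i j, starProj c a i j ≠ 0 →
      spectralGap (commMatrix (SimpleGraph.starGraph c) ω) ≤ 1 - |starEigenvalue ω a| := by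
    intro a i j hne
    refine spectralGap_le_of_real_eigenvector (f := fun r => ((starProj c a r j : ℝ) : ℂ)) ?_ ?_ ?_
    · cases a <;> simp only [starEigenvalue] <;> linarith
    · exact Function.ne_iff.2 ⟨i, by simpa using hne⟩
    · intro i
      exact_mod_cast starProj_eigen c ω (by omega) a i j
  refine le_min ?_ ?_
  · have : Nontrivial (Fin n) := Fin.nontrivial_iff_two_le.2 (by omega)
    obtain ⟨i, hi⟩ := exists_ne c
    have hn3 : (3 : ℝ) ≤ n := by exact_mod_cast hn
    -- A diagonal entry `1 - 1 / (n - 1)` at a leaf is nonzero only for `n ≥ 3`; on two vertices `ω`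
    -- is not an eigenvalue.
    have := key true i i (by
      simp only [starProj, hi, or_self, if_false, if_true]
      have : 1 / ((n : ℝ) - 1) < 1 := by rw [div_lt_one] <;> linarith
      linarith)
    simpa [starEigenvalue, abs_of_pos h0] using this
  · exact key false c c (by simp [starProj, starSign, starCentrality])

end Star

/-! ### Sums of inverse squares over the frequencies of a cycle -/

lemma sum_inv_sq_nat_le {α : Type*} {s : Finset α} {φ : α → ℕ} (hφ : Set.InjOn φ s) :
    ∑ a ∈ s, 1 / (φ a : ℝ) ^ 2 ≤ 2 := by
  classical
  -- The value `0` may be attained, but contributes `1 / 0 = 0`.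
  rw [← Finset.sum_image (f := fun q : ℕ => 1 / (q : ℝ) ^ 2) hφ,
    ← Finset.sum_erase (a := 0) _ (by simp)]
  have hsub : (s.image φ).erase 0 ⊆ Finset.Ioo 0 ((s.image φ).sup id + 1) := fun q hq => by
    rw [Finset.mem_erase] at hq
    exact Finset.mem_Ioo.2
      ⟨Nat.pos_of_ne_zero hq.1, Nat.lt_succ_of_le (Finset.le_sup (f := id) hq.2)⟩
  refine (Finset.sum_le_sum_of_subset_of_nonneg hsub fun _ _ _ => by positivity).trans ?_
  simpa using sum_Ioo_inv_sq_le (α := ℝ) 0 ((s.image φ).sup id + 1)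

lemma sum_inv_sq_int_le {α : Type*} {s : Finset α} {g : α → ℤ} (hg : Function.Injective g) :
    ∑ a ∈ s, 1 / (g a : ℝ) ^ 2 ≤ 4 := by
  classical
  have h : ∀ a, 1 / (g a : ℝ) ^ 2 = 1 / ((g a).natAbs : ℝ) ^ 2 := fun a => by
    rw [Nat.cast_natAbs, Int.cast_abs, sq_abs]
  simp only [h]
  rw [← Finset.sum_filter_add_sum_filter_not s fun a => 0 ≤ g a]
  refine (add_le_add (sum_inv_sq_nat_le ?_) (sum_inv_sq_nat_le ?_)).trans_eq (by norm_num)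
  all_goals
    intro a ha b hb hab
    rw [Finset.mem_coe, Finset.mem_filter] at ha hb
    beta_reduce at hab
    exact hg (by omega)

/-- Jordan's inequality, squared to allow either sign of `x`. -/
lemma sq_le_sin_sq {x : ℝ} (hx : |x| ≤ 1) : x ^ 2 ≤ Real.sin (Real.pi / 2 * x) ^ 2 := by
  wlog h : 0 ≤ x generalizing x
  · have := this (x := -x) (by rwa [abs_neg]) (by linarith)
    simpa using this
  have hπ := Real.pi_pos
  rw [abs_of_nonneg h] at hx
  have := Real.mul_le_sin (x := Real.pi / 2 * x) (by positivity) (by nlinarith)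
  have e : 2 / Real.pi * (Real.pi / 2 * x) = x := by field_simp
  rw [e] at this
  exact pow_le_pow_left₀ h this 2

/-! ### Characters, mixing sum and spectral gap of the cycle -/

section Cycle

variable {n : ℕ}

/-- The character `x ↦ exp (2 π i x / (n + 3))` of the vertices of a cycle. -/
noncomputable def cycleChar (x : Fin (n + 3)) : ℂ := ZMod.stdAddChar (N := n + 3) x

lemma cycleChar_add (x y : Fin (n + 3)) : cycleChar (x + y) = cycleChar x * cycleChar y :=
  AddChar.map_add_eq_mul (ZMod.stdAddChar (N := n + 3)) x y

lemma norm_cycleChar (x : Fin (n + 3)) : ‖cycleChar x‖ = 1 :=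
  AddChar.norm_apply (ZMod.stdAddChar (N := n + 3)) x

lemma sum_cycleChar_mul (x : Fin (n + 3)) :
    ∑ a, cycleChar (a * x) = if x = 0 then ((n + 3 : ℕ) : ℂ) else 0 := by
  refine (AddChar.sum_mulShift (R := ZMod (n + 3)) (R' := ℂ) x
    (ZMod.isPrimitive_stdAddChar (n + 3))).trans ?_
  rw [ZMod.card, Nat.cast_ite, Nat.cast_zero]
  rfl

lemma cycleChar_add_cycleChar_neg (a : Fin (n + 3)) :
    cycleChar a + cycleChar (-a) = 2 * (Real.cos (2 * Real.pi * (a.val / (n + 3 : ℕ))) : ℝ) := by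
  have h1 : cycleChar a = Complex.exp ((2 * Real.pi * (a.val / (n + 3 : ℕ)) : ℝ) * Complex.I) := by
    have h := congrArg (fun z : Circle => (z : ℂ)) (ZMod.toCircle_eq_circleExp (N := n + 3) a)
    simp only [Circle.coe_exp] at h
    exact h
  have h2 : cycleChar (-a) = (cycleChar a)⁻¹ :=
    AddChar.map_neg_eq_inv (ZMod.stdAddChar (N := n + 3)) a
  rw [h2, h1, ← Complex.exp_neg, Complex.ofReal_cos, Complex.two_cos, neg_mul]

/-- The eigenvalue of a lazy walk on the cycle of length `n + 3` at the frequency `a`. -/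
noncomputable def cycleEigenvalue (ω : ℝ) (a : Fin (n + 3)) : ℝ :=
  ω + (1 - ω) * Real.cos (2 * Real.pi * (a.val / (n + 3 : ℕ)))

lemma sum_commMatrix_cycle (ω : ℝ) (x : Fin (n + 3)) (f : Fin (n + 3) → ℂ) :
    ∑ y, (commMatrix (SimpleGraph.cycleGraph (n + 3)) ω x y : ℂ) * f y =
      ω * f x + (1 - ω) / 2 * (f (x + 1) + f (x - 1)) := by
  have hne1 : x + 1 ≠ x := by simp
  have hne2 : x - 1 ≠ x := by simp
  -- The two neighbours are distinct because the length is at least `3`.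
  have hne3 : x + 1 ≠ x - 1 := by
    intro h
    rw [eq_sub_iff_add_eq, add_assoc, add_eq_left] at h
    have := congrArg Fin.val h
    simp only [Fin.val_add, Fin.val_one, Fin.val_zero] at this
    rw [Nat.mod_eq_of_lt (by omega)] at this
    omega
  have hentry : ∀ y, (commMatrix (SimpleGraph.cycleGraph (n + 3)) ω x y : ℂ) * f y =
      (if y = x then ω * f x else 0) + ((if y = x + 1 then (1 - ω) / 2 * f (x + 1) else 0) +
        if y = x - 1 then (1 - ω) / 2 * f (x - 1) else 0) := by
    intro y
    have hadj : (SimpleGraph.cycleGraph (n + 3)).Adj x y ↔ y = x + 1 ∨ y = x - 1 := by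
      rw [SimpleGraph.cycleGraph_adj, or_comm]
      refine or_congr ?_ ?_
      · rw [sub_eq_iff_eq_add, add_comm 1 x]
      · constructor <;> intro h
        · rw [← h]; simp
        · rw [h]; simp
    by_cases hy : y = x
    · subst hy
      simp [commMatrix_apply_self, hne1.symm, hne2.symm]
    · by_cases h : (SimpleGraph.cycleGraph (n + 3)).Adj x y
      · rw [commMatrix_apply_of_adj h, SimpleGraph.cycleGraph_degree_three_le]
        rcases hadj.1 h with rfl | rfl
        · simp [hne3]
        · simp [hne3.symm, hne2]
      · rw [commMatrix_apply_of_not_adj (Ne.symm hy) h]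
        rw [hadj, not_or] at h
        simp [hy, h.1, h.2]
  simp only [hentry, Finset.sum_add_distrib, Finset.sum_ite_eq', Finset.mem_univ, if_true]
  ring

lemma sum_commMatrix_cycle_eq_one (ω : ℝ) (x : Fin (n + 3)) :
    ∑ y, commMatrix (SimpleGraph.cycleGraph (n + 3)) ω x y = 1 := by
  have := sum_commMatrix_cycle ω x fun _ => 1
  simp only [mul_one] at this
  have h' : ((∑ y, commMatrix (SimpleGraph.cycleGraph (n + 3)) ω x y : ℝ) : ℂ) = 1 := by
    rw [Complex.ofReal_sum, this]; ring
  exact_mod_cast h'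

lemma cycleChar_eigen (ω : ℝ) (a x y : Fin (n + 3)) :
    ∑ r, (commMatrix (SimpleGraph.cycleGraph (n + 3)) ω x r : ℂ) * cycleChar (a * (r - y)) =
      cycleEigenvalue ω a * cycleChar (a * (x - y)) := by
  -- The identity is checked in the ring `ZMod (n + 3)`, definitionally equal to `Fin (n + 3)`.
  have h1 : a * (x + 1 - y) = a * (x - y) + a := by
    have h : ∀ a x y : ZMod (n + 3), a * (x + 1 - y) = a * (x - y) + a := fun a x y => by ring
    exact h a x y
  have h2 : a * (x - 1 - y) = a * (x - y) + -a := by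
    have h : ∀ a x y : ZMod (n + 3), a * (x - 1 - y) = a * (x - y) + -a := fun a x y => by ring
    exact h a x y
  rw [sum_commMatrix_cycle ω x fun r => cycleChar (a * (r - y)), h1, h2, cycleChar_add,
    cycleChar_add, ← mul_add, cycleChar_add_cycleChar_neg, cycleEigenvalue]
  push_cast
  ring

lemma one_sub_cycleEigenvalue (ω : ℝ) (a : Fin (n + 3)) : 1 - cycleEigenvalue ω a =
    2 * (1 - ω) * Real.sin (Real.pi * (a.val / (n + 3 : ℕ))) ^ 2 := by
  rw [cycleEigenvalue, mul_assoc, Real.cos_two_mul, Real.sin_sq]; ring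

lemma one_add_cycleEigenvalue (ω : ℝ) (a : Fin (n + 3)) : 1 + cycleEigenvalue ω a =
    2 * ω + 2 * (1 - ω) * Real.cos (Real.pi * (a.val / (n + 3 : ℕ))) ^ 2 := by
  rw [cycleEigenvalue, mul_assoc, Real.cos_two_mul]; ring

variable {ω : ℝ}

/-- With `r` the cyclic distance from `a` to `0`, Jordan's inequality bounds the sine below by `2 r
/ N`. Both candidates for `r` are kept in the bound, so that each can be summed over all `a` without
splitting the range. -/
lemma inv_one_sub_cycleEigenvalue_le (h1 : ω < 1) {a : Fin (n + 3)} (ha : a ≠ 0) :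
    0 < 1 - cycleEigenvalue ω a ∧ 1 / (1 - cycleEigenvalue ω a) ≤
      ((n + 3 : ℕ) : ℝ) ^ 2 / (8 * (1 - ω)) *
        (1 / (((a.val : ℤ) : ℝ)) ^ 2 + 1 / (((n + 3 : ℕ) - a.val : ℤ) : ℝ) ^ 2) := by
  have hω : 0 < 1 - ω := by linarith
  have hN : (0 : ℝ) < (n + 3 : ℕ) := by positivity
  have ha0 : (0 : ℝ) < a.val := by
    exact_mod_cast Nat.pos_of_ne_zero fun h => ha (Fin.ext h)
  have haN : (a.val : ℝ) < (n + 3 : ℕ) := by exact_mod_cast a.isLt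
  rw [one_sub_cycleEigenvalue]
  simp only [Int.cast_sub, Int.cast_natCast]
  set N : ℝ := ((n + 3 : ℕ) : ℝ)
  set j : ℝ := (a.val : ℝ)
  have key : ∃ r : ℝ, 0 < r ∧ (r = j ∨ r = N - j) ∧
      (2 * r / N) ^ 2 ≤ Real.sin (Real.pi * (j / N)) ^ 2 := by
    rcases le_total (2 * j) N with h | h
    · refine ⟨j, ha0, Or.inl rfl, ?_⟩
      convert sq_le_sin_sq (x := 2 * j / N) ?_ using 3
      · field_simp
      · rw [abs_of_nonneg (by positivity), div_le_one hN]; exact h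
    · refine ⟨N - j, by linarith, Or.inr rfl, ?_⟩
      rw [← Real.sin_pi_sub]
      convert sq_le_sin_sq (x := 2 * (N - j) / N) ?_ using 3
      · field_simp
      · have : 0 < N - j := by linarith
        rw [abs_of_nonneg (by positivity), div_le_one hN]; linarith
  obtain ⟨r, hr, hrj, hsin⟩ := key
  have hpos : 0 < (2 * r / N) ^ 2 := by positivity
  have hsin0 := hpos.trans_le hsin
  refine ⟨by positivity, ?_⟩
  calc 1 / (2 * (1 - ω) * Real.sin (Real.pi * (j / N)) ^ 2)
      ≤ 1 / (2 * (1 - ω) * (2 * r / N) ^ 2) := by gcongr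
    _ = N ^ 2 / (8 * (1 - ω)) * (1 / r ^ 2) := by field_simp; try norm_num
    _ ≤ _ := by
        gcongr
        have h2 : 0 ≤ 1 / j ^ 2 := by positivity
        have h3 : 0 ≤ 1 / (N - j) ^ 2 := by positivity
        rcases hrj with rfl | rfl <;> linarith

/-- Away from frequency `N / 2` the squared cosine suffices and `2 ω` is dropped. At `N / 2` the
cosine vanishes and only `2 ω` is left, while the first term of the bound is `1 / 0 = 0`. -/
lemma inv_one_add_cycleEigenvalue_le (h0 : 0 < ω) (h1 : ω < 1) (a : Fin (n + 3)) :
    0 < 1 + cycleEigenvalue ω a ∧ 1 / (1 + cycleEigenvalue ω a) ≤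
      ((n + 3 : ℕ) : ℝ) ^ 2 / (2 * (1 - ω)) * (1 / (((n + 3 : ℕ) - 2 * a.val : ℤ) : ℝ) ^ 2) +
        if 2 * a.val = n + 3 then 1 / (2 * ω) else 0 := by
  have hω : 0 < 1 - ω := by linarith
  have hN : (0 : ℝ) < (n + 3 : ℕ) := by positivity
  have haN : (a.val : ℝ) < (n + 3 : ℕ) := by exact_mod_cast a.isLt
  have hne : ¬ 2 * a.val = n + 3 → ((n + 3 : ℕ) : ℝ) - 2 * a.val ≠ 0 := fun h h' =>
    h (by exact_mod_cast (sub_eq_zero.1 h').symm)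
  rw [one_add_cycleEigenvalue]
  simp only [Int.cast_sub, Int.cast_mul, Int.cast_natCast, Int.cast_ofNat]
  set N : ℝ := ((n + 3 : ℕ) : ℝ)
  have ha0 : (0 : ℝ) ≤ a.val := by positivity
  set j : ℝ := (a.val : ℝ)
  refine ⟨by positivity, ?_⟩
  split_ifs with h
  · have : 1 / (2 * ω + 2 * (1 - ω) * Real.cos (Real.pi * (j / N)) ^ 2) ≤ 1 / (2 * ω) := by
      gcongr
      have : 0 ≤ 2 * (1 - ω) * Real.cos (Real.pi * (j / N)) ^ 2 := by positivity
      linarith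
    have : 0 ≤ N ^ 2 / (2 * (1 - ω)) * (1 / (N - 2 * j) ^ 2) := by positivity
    linarith
  · have hr := hne h
    have hcos : ((N - 2 * j) / N) ^ 2 ≤ Real.cos (Real.pi * (j / N)) ^ 2 := by
      rw [← Real.sin_pi_div_two_sub]
      convert sq_le_sin_sq (x := (N - 2 * j) / N) ?_ using 3
      · field_simp
      · rw [abs_div, abs_of_pos hN, div_le_one hN, abs_le]
        constructor <;> linarith
    have hpos : 0 < ((N - 2 * j) / N) ^ 2 := by positivity
    calc 1 / (2 * ω + 2 * (1 - ω) * Real.cos (Real.pi * (j / N)) ^ 2)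
        ≤ 1 / (2 * (1 - ω) * ((N - 2 * j) / N) ^ 2) := by
          refine one_div_le_one_div_of_le (by positivity) ?_
          have := mul_le_mul_of_nonneg_left hcos (by positivity : 0 ≤ 2 * (1 - ω))
          linarith
      _ = N ^ 2 / (2 * (1 - ω)) * (1 / (N - 2 * j) ^ 2) + 0 := by field_simp; norm_num

/-- A bound for the mixing sum of a cycle of length `N`. -/
noncomputable def cycleMixingSum (N : ℕ) (ω : ℝ) : ℝ :=
  3 * (N : ℝ) ^ 2 / (1 - ω) + if Even N then 1 / (2 * ω) else 0

lemma abs_cycleEigenvalue_lt_one (h0 : 0 < ω) (h1 : ω < 1) {a : Fin (n + 3)} (ha : a ≠ 0) :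
    |cycleEigenvalue ω a| < 1 :=
  abs_lt.2 ⟨by linarith [(inv_one_add_cycleEigenvalue_le h0 h1 a).1],
    by linarith [(inv_one_sub_cycleEigenvalue_le h1 ha).1]⟩

/-- Each `1 / (1 - |λ|)` is at most the sum of `1 / (1 - λ)` and `1 / (1 + λ)`. Three inverse-square
sums, each at most `4`, give the factor `3 = (4 + 4) / 8 + 4 / 2`. -/
lemma sum_inv_gap_cycle_le (h0 : 0 < ω) (h1 : ω < 1) :
    ∑ a ∈ Finset.univ.erase (0 : Fin (n + 3)), 1 / (1 - |cycleEigenvalue ω a|) ≤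
      cycleMixingSum (n + 3) ω := by
  have hω : 0 < 1 - ω := by linarith
  set N : ℝ := ((n + 3 : ℕ) : ℝ) with hN
  have hterm : ∀ a ∈ Finset.univ.erase (0 : Fin (n + 3)), 1 / (1 - |cycleEigenvalue ω a|) ≤
      N ^ 2 / (8 * (1 - ω)) *
        (1 / (((a.val : ℤ) : ℝ)) ^ 2 + 1 / (((n + 3 : ℕ) - a.val : ℤ) : ℝ) ^ 2) +
      (N ^ 2 / (2 * (1 - ω)) * (1 / (((n + 3 : ℕ) - 2 * a.val : ℤ) : ℝ) ^ 2) +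
        if 2 * a.val = n + 3 then 1 / (2 * ω) else 0) := by
    intro a ha
    obtain ⟨hp, hp'⟩ := inv_one_sub_cycleEigenvalue_le h1 (Finset.ne_of_mem_erase ha)
    obtain ⟨hm, hm'⟩ := inv_one_add_cycleEigenvalue_le h0 h1 a
    have hp0 := (one_div_pos.2 hp).le
    have hm0 := (one_div_pos.2 hm).le
    rcases abs_cases (cycleEigenvalue ω a) with ⟨h, _⟩ | ⟨h, _⟩
    · rw [h]; linarith
    · rw [h, sub_neg_eq_add]; linarith
  refine (Finset.sum_le_sum hterm).trans ?_
  simp only [Finset.sum_add_distrib, ← Finset.mul_sum]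
  have s1 : ∑ a ∈ Finset.univ.erase (0 : Fin (n + 3)), 1 / (((a.val : ℤ) : ℝ)) ^ 2 ≤ 4 :=
    sum_inv_sq_int_le fun a b h => Fin.ext (by exact_mod_cast h)
  have s2 : ∑ a ∈ Finset.univ.erase (0 : Fin (n + 3)),
      1 / (((n + 3 : ℕ) - a.val : ℤ) : ℝ) ^ 2 ≤ 4 :=
    sum_inv_sq_int_le fun a b h => Fin.ext (by omega)
  have s3 : ∑ a ∈ Finset.univ.erase (0 : Fin (n + 3)),
      1 / (((n + 3 : ℕ) - 2 * a.val : ℤ) : ℝ) ^ 2 ≤ 4 :=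
    sum_inv_sq_int_le fun a b h => Fin.ext (by omega)
  have s4 : ∑ a ∈ Finset.univ.erase (0 : Fin (n + 3)),
      (if 2 * a.val = n + 3 then 1 / (2 * ω) else 0) ≤
        if Even (n + 3) then 1 / (2 * ω) else 0 := by
    split_ifs with h
    · obtain ⟨q, hq⟩ := h
      have hiff : ∀ a : Fin (n + 3), 2 * a.val = n + 3 ↔ a = ⟨q, by omega⟩ := fun a => by
        rw [Fin.ext_iff]
        change 2 * a.val = n + 3 ↔ a.val = q
        omega
      simp only [hiff, Finset.sum_ite_eq']
      split_ifs <;> first | exact le_rfl | positivity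
    · refine (Finset.sum_eq_zero fun a _ => if_neg fun h' => h ⟨a.val, by omega⟩).le
  have c1 : 0 ≤ N ^ 2 / (8 * (1 - ω)) := by positivity
  have c2 : 0 ≤ N ^ 2 / (2 * (1 - ω)) := by positivity
  have e : 3 * N ^ 2 / (1 - ω) = N ^ 2 / (8 * (1 - ω)) * (4 + 4) + N ^ 2 / (2 * (1 - ω)) * 4 := by
    field_simp; ring
  rw [cycleMixingSum, ← hN, e]
  linarith [mul_le_mul_of_nonneg_left (add_le_add s1 s2) c1, mul_le_mul_of_nonneg_left s3 c2]

/-- Orthogonality of characters is the resolution of the identity, frequency `0` being the uniform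
distribution; each eigenmatrix has entries of modulus `1 / N`, hence rows of norm `1`. -/
lemma mixesWithin_cycle (h0 : 0 < ω) (h1 : ω < 1) :
    MixesWithin (commMatrix (SimpleGraph.cycleGraph (n + 3)) ω) (fun _ => 1 / ((n + 3 : ℕ) : ℝ))
      (cycleMixingSum (n + 3) ω) := by
  have hN : ((n + 3 : ℕ) : ℂ) ≠ 0 := by exact_mod_cast (by omega : n + 3 ≠ 0)
  have h := mixesWithin_of_resolution (W := commMatrix (SimpleGraph.cycleGraph (n + 3)) ω)
    (ρ := fun _ => 1 / ((n + 3 : ℕ) : ℝ)) (I := Finset.univ.erase (0 : Fin (n + 3)))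
    (E := fun a x y => 1 / ((n + 3 : ℕ) : ℂ) * cycleChar (a * (x - y)))
    (l := cycleEigenvalue ω) (c := fun _ => 1) ?_ ?_ ?_ ?_ ?_
  · intro i t
    refine (h i t).trans ?_
    simp only [one_mul]
    exact sum_inv_gap_cycle_le h0 h1
  · exact sum_commMatrix_cycle_eq_one ω
  · intro a _ x y
    simp only [mul_left_comm _ (1 / ((n + 3 : ℕ) : ℂ)), ← Finset.mul_sum, cycleChar_eigen]
  · intro x y
    have hs := sum_cycleChar_mul (x - y)
    rw [← Finset.add_sum_erase _ _ (Finset.mem_univ (0 : Fin (n + 3)))] at hs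
    have h00 : cycleChar (0 * (x - y)) = 1 := by
      rw [zero_mul]
      exact AddChar.map_zero_eq_one (ZMod.stdAddChar (N := n + 3))
    rw [h00] at hs
    rw [← Finset.mul_sum]
    simp only [Complex.ofReal_div, Complex.ofReal_one, Complex.ofReal_natCast]
    rw [← mul_one_add, hs]
    simp only [sub_eq_zero]
    split_ifs
    · exact one_div_mul_cancel hN
    · exact mul_zero _
  · intro a ha
    exact abs_cycleEigenvalue_lt_one h0 h1 (Finset.ne_of_mem_erase ha)
  · intro a _ x
    refine le_of_eq ?_
    simp only [norm_mul, norm_cycleChar, mul_one, norm_div, norm_one, Complex.norm_natCast,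
      Finset.sum_const, Finset.card_univ, Fintype.card_fin, nsmul_eq_mul]
    have : ((n + 3 : ℕ) : ℝ) ≠ 0 := by exact_mod_cast (by omega : n + 3 ≠ 0)
    field_simp

lemma one_le_cycleMixingSum {N : ℕ} (hN : 1 ≤ N) (h0 : 0 < ω) (h1 : ω < 1) :
    1 ≤ cycleMixingSum N ω := by
  have hω : 0 < 1 - ω := by linarith
  have hN' : (1 : ℝ) ≤ N := by exact_mod_cast hN
  have h : 1 ≤ 3 * (N : ℝ) ^ 2 / (1 - ω) := by
    rw [le_div_iff₀ hω]; nlinarith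
  have : 0 ≤ if Even N then 1 / (2 * ω) else 0 := by split_ifs <;> positivity
  unfold cycleMixingSum
  linarith

/-- Stated for a general `g` to cover both the spectral gap and the minimum in the claim. The
constant is `6 π² ≤ 60` plus `1` from the frequency `N / 2`. -/
lemma cycleMixingSum_mul_le {N : ℕ} (hN : 1 ≤ N) (h0 : 0 < ω) (h1 : ω < 1) {g : ℝ}
    (hsin : g ≤ 2 * (1 - ω) * Real.sin (Real.pi / N) ^ 2) (heven : Even N → g ≤ 2 * ω) :
    cycleMixingSum N ω * g ≤ 61 := by
  have hω : 0 < 1 - ω := by linarith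
  have hN' : (0 : ℝ) < N := by exact_mod_cast hN
  have hπ := Real.pi_pos
  have hs : Real.sin (Real.pi / N) ^ 2 ≤ (Real.pi / N) ^ 2 := by
    rw [sq_le_sq]
    simpa using Real.abs_sin_le_abs (x := Real.pi / N)
  have hπ2 : Real.pi ^ 2 ≤ 10 := by nlinarith [Real.pi_lt_d2]
  have h3 : 3 * (N : ℝ) ^ 2 / (1 - ω) * g ≤ 60 := by
    calc 3 * (N : ℝ) ^ 2 / (1 - ω) * g
        ≤ 3 * (N : ℝ) ^ 2 / (1 - ω) * (2 * (1 - ω) * (Real.pi / N) ^ 2) := by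
          gcongr
          exact hsin.trans (by gcongr)
      _ = 6 * Real.pi ^ 2 := by field_simp; norm_num
      _ ≤ 60 := by linarith
  have h4 : (if Even N then 1 / (2 * ω) else 0) * g ≤ 1 := by
    split_ifs with h
    · rw [one_div, inv_mul_le_iff₀ (by positivity), mul_one]
      exact heven h
    · simp
  rw [cycleMixingSum, add_mul]
  linarith

lemma cycleEigenvalue_one (ω : ℝ) : cycleEigenvalue ω (1 : Fin (n + 3)) =
    1 - 2 * (1 - ω) * Real.sin (Real.pi / (n + 3 : ℕ)) ^ 2 := by
  have h := one_sub_cycleEigenvalue ω (1 : Fin (n + 3))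
  rw [Fin.val_one, Nat.cast_one, mul_one_div] at h
  linarith

lemma exists_cycleEigenvalue_eq (ω : ℝ) (h : Even (n + 3)) :
    ∃ a : Fin (n + 3), cycleEigenvalue ω a = 2 * ω - 1 := by
  obtain ⟨q, hq⟩ := h
  refine ⟨⟨q, by omega⟩, ?_⟩
  have hq0 : (q : ℝ) ≠ 0 := by exact_mod_cast (by omega : q ≠ 0)
  have e : 2 * Real.pi * ((q : ℝ) / (n + 3 : ℕ)) = Real.pi := by
    rw [hq]; push_cast; field_simp; norm_num
  rw [cycleEigenvalue, e, Real.cos_pi]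
  ring

lemma cycleChar_ne_zero (x : Fin (n + 3)) : cycleChar x ≠ 0 :=
  norm_ne_zero_iff.1 (by rw [norm_cycleChar]; exact one_ne_zero)

lemma cycleChar_mul_ne_zero (a : Fin (n + 3)) : (fun r => cycleChar (a * r)) ≠ 0 :=
  Function.ne_iff.2 ⟨0, cycleChar_ne_zero _⟩

lemma cycleChar_mul_eigen (ω : ℝ) (a x : Fin (n + 3)) :
    ∑ r, (commMatrix (SimpleGraph.cycleGraph (n + 3)) ω x r : ℂ) * cycleChar (a * r) =
      cycleEigenvalue ω a * cycleChar (a * x) := by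
  simpa using cycleChar_eigen ω a x 0

lemma cycleEigenvalue_one_ne (h1 : ω < 1) : cycleEigenvalue ω (1 : Fin (n + 3)) ≠ 1 := by
  have := (inv_one_sub_cycleEigenvalue_le h1 (one_ne_zero : (1 : Fin (n + 3)) ≠ 0)).1
  linarith

lemma spectralGap_cycle_le (h1 : ω < 1) :
    spectralGap (commMatrix (SimpleGraph.cycleGraph (n + 3)) ω) ≤
      2 * (1 - ω) * Real.sin (Real.pi / (n + 3 : ℕ)) ^ 2 := by
  have h := spectralGap_le_of_real_eigenvector (cycleEigenvalue_one_ne h1)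
    (cycleChar_mul_ne_zero 1) (cycleChar_mul_eigen ω (1 : Fin (n + 3)))
  have := le_abs_self (cycleEigenvalue ω (1 : Fin (n + 3)))
  rw [cycleEigenvalue_one] at h this
  linarith

lemma spectralGap_cycle_le_of_even (h1 : ω < 1) (he : Even (n + 3)) :
    spectralGap (commMatrix (SimpleGraph.cycleGraph (n + 3)) ω) ≤ 2 * ω := by
  obtain ⟨a, ha⟩ := exists_cycleEigenvalue_eq ω he
  have h := spectralGap_le_of_real_eigenvector (by rw [ha]; linarith)
    (cycleChar_mul_ne_zero a) (cycleChar_mul_eigen ω a)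
  rw [ha] at h
  have := neg_abs_le (2 * ω - 1)
  linarith

end Cycle

/-! ### Binomial averages -/

/-- The full series is the expected time a fair-coin count spends at `r`, which is `2`. Pascal's
rule writes each partial sum for `r + 1` as the mean of shorter sums for `r` and `r + 1`. -/
lemma sum_half_pow_mul_choose_le (r t : ℕ) :
    ∑ s ∈ Finset.range t, (1 / 2 : ℝ) ^ s * (s.choose r : ℝ) ≤ 2 := by
  induction r generalizing t with
  | zero =>
    simp only [Nat.choose_zero_right, Nat.cast_one, mul_one]
    exact sum_geometric_two_le t
  | succ r ihr =>
    induction t with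
    | zero => simp
    | succ t iht =>
      rw [Finset.sum_range_succ']
      have e : ∀ s : ℕ, (1 / 2 : ℝ) ^ (s + 1) * ((s + 1).choose (r + 1) : ℝ) =
          1 / 2 * ((1 / 2 : ℝ) ^ s * (s.choose r : ℝ)) +
            1 / 2 * ((1 / 2 : ℝ) ^ s * (s.choose (r + 1) : ℝ)) := fun s => by
        rw [Nat.choose_succ_succ]; push_cast; ring
      simp only [e, Finset.sum_add_distrib, ← Finset.mul_sum]
      simp only [Nat.choose_zero_succ, Nat.cast_zero, mul_zero, add_zero]
      linarith [ihr t]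

lemma sum_binomial_average_le {d : ℕ → ℝ} {S : ℝ} (hd : ∀ r, 0 ≤ d r)
    (hS : ∀ t, ∑ r ∈ Finset.range t, d r ≤ S) (t : ℕ) :
    ∑ s ∈ Finset.range t, ∑ r ∈ Finset.range (s + 1), (1 / 2 : ℝ) ^ s * (s.choose r : ℝ) * d r ≤
      2 * S := by
  calc _ ≤ ∑ s ∈ Finset.range t, ∑ r ∈ Finset.range t, (1 / 2 : ℝ) ^ s * (s.choose r : ℝ) * d r := by
        refine Finset.sum_le_sum fun s hs => ?_
        refine Finset.sum_le_sum_of_subset_of_nonneg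
          (Finset.range_subset_range.2 (Finset.mem_range.1 hs)) fun r _ _ => ?_
        have := hd r
        positivity
    _ = ∑ r ∈ Finset.range t, (∑ s ∈ Finset.range t, (1 / 2 : ℝ) ^ s * (s.choose r : ℝ)) * d r := by
        rw [Finset.sum_comm]; simp only [Finset.sum_mul]
    _ ≤ ∑ r ∈ Finset.range t, 2 * d r := Finset.sum_le_sum fun r _ =>
        mul_le_mul_of_nonneg_right (sum_half_pow_mul_choose_le r t) (hd r)
    _ ≤ 2 * S := by rw [← Finset.mul_sum]; linarith [hS t]

/-! ### Averages of two independent walks -/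

section Product

variable {V : Type} [Fintype V] [DecidableEq V] {U : Matrix V V ℝ}

lemma pow_apply_nonneg (h : ∀ i j, 0 ≤ U i j) (s : ℕ) (i j : V) : 0 ≤ (U ^ s) i j := by
  induction s generalizing i j with
  | zero => rw [pow_zero, Matrix.one_apply]; split_ifs <;> norm_num
  | succ s ih =>
    rw [pow_succ, Matrix.mul_apply]
    exact Finset.sum_nonneg fun l _ => mul_nonneg (ih i l) (h l j)

lemma sum_pow_apply (h : ∀ i, ∑ j, U i j = 1) (s : ℕ) (i : V) : ∑ j, (U ^ s) i j = 1 := by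
  induction s generalizing i with
  | zero => simp [Matrix.one_apply]
  | succ s ih =>
    simp only [pow_succ, Matrix.mul_apply]
    rw [Finset.sum_comm]
    simp only [← Finset.mul_sum, h, mul_one, ih]

variable {W : Matrix (V × V) (V × V) ℝ}

lemma pow_apply_of_average
    (hW : W = (1 / 2 : ℝ) • (Matrix.kronecker U 1 + Matrix.kronecker 1 U)) (s : ℕ)
    (x y : V × V) :
    (W ^ s) x y = ∑ r ∈ Finset.range (s + 1),
      (1 / 2 : ℝ) ^ s * (s.choose r : ℝ) * ((U ^ r) x.1 y.1 * (U ^ (s - r)) x.2 y.2) := by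
  have hl : ∀ r, (Matrix.kronecker U (1 : Matrix V V ℝ)) ^ r = Matrix.kronecker (U ^ r) 1 := by
    intro r
    induction r with
    | zero => rw [pow_zero, pow_zero]; exact Matrix.one_kronecker_one.symm
    | succ r ih =>
      rw [pow_succ, ih, pow_succ]
      exact (Matrix.mul_kronecker_mul _ _ _ _).symm.trans (by rw [one_mul]; rfl)
  have hr : ∀ r, (Matrix.kronecker (1 : Matrix V V ℝ) U) ^ r = Matrix.kronecker 1 (U ^ r) := by
    intro r
    induction r with
    | zero => rw [pow_zero, pow_zero]; exact Matrix.one_kronecker_one.symm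
    | succ r ih =>
      rw [pow_succ, ih, pow_succ]
      exact (Matrix.mul_kronecker_mul _ _ _ _).symm.trans (by rw [one_mul]; rfl)
  have hmul : ∀ A B : Matrix V V ℝ,
      Matrix.kronecker A 1 * Matrix.kronecker 1 B = Matrix.kronecker A B := fun A B =>
    (Matrix.mul_kronecker_mul _ _ _ _).symm.trans (by rw [one_mul, mul_one]; rfl)
  have hmul' : ∀ A B : Matrix V V ℝ,
      Matrix.kronecker 1 B * Matrix.kronecker A 1 = Matrix.kronecker A B := fun A B =>
    (Matrix.mul_kronecker_mul _ _ _ _).symm.trans (by rw [one_mul, mul_one]; rfl)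
  have hcomm : Commute (Matrix.kronecker U (1 : Matrix V V ℝ)) (Matrix.kronecker 1 U) :=
    (hmul U U).trans (hmul' U U).symm
  rw [hW, smul_pow, hcomm.add_pow, Matrix.smul_apply, Matrix.sum_apply, smul_eq_mul,
    Finset.mul_sum]
  refine Finset.sum_congr rfl fun r _ => ?_
  rw [hl, hr, hmul, ← nsmul_eq_mul', Matrix.smul_apply, nsmul_eq_mul]
  simp only [Matrix.kronecker, Matrix.kroneckerMap_apply]
  ring

/-- At time `s`, the averaged walk has made a binomial number `r` of steps in one coordinate and `s
- r` in the other. The distance of a product of distributions is at most the sum of the two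
distances, and each coordinate contributes `2 * S` by `sum_binomial_average_le`. -/
lemma MixesWithin.average {ρ : V → ℝ} {S : ℝ} (hU0 : ∀ i j, 0 ≤ U i j)
    (hU1 : ∀ i, ∑ j, U i j = 1) (hρ0 : ∀ i, 0 ≤ ρ i) (hρ1 : ∑ i, ρ i = 1)
    (hU : MixesWithin U ρ S)
    (hW : W = (1 / 2 : ℝ) • (Matrix.kronecker U 1 + Matrix.kronecker 1 U)) :
    MixesWithin W (fun x => ρ x.1 * ρ x.2) (4 * S) := by
  intro x t
  let d : V → ℕ → ℝ := fun i s => ∑ j, |(U ^ s) i j - ρ j|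
  have hd : ∀ i s, 0 ≤ d i s := fun i s => Finset.sum_nonneg fun j _ => abs_nonneg _
  have hprod : ∀ p q, ∑ y : V × V, |(U ^ p) x.1 y.1 * (U ^ q) x.2 y.2 - ρ y.1 * ρ y.2| ≤
      d x.1 p + d x.2 q := by
    intro p q
    calc ∑ y : V × V, |(U ^ p) x.1 y.1 * (U ^ q) x.2 y.2 - ρ y.1 * ρ y.2|
        ≤ ∑ y : V × V, (|(U ^ p) x.1 y.1 - ρ y.1| * (U ^ q) x.2 y.2 +
            ρ y.1 * |(U ^ q) x.2 y.2 - ρ y.2|) := by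
          refine Finset.sum_le_sum fun y _ => ?_
          have e : (U ^ p) x.1 y.1 * (U ^ q) x.2 y.2 - ρ y.1 * ρ y.2 =
              ((U ^ p) x.1 y.1 - ρ y.1) * (U ^ q) x.2 y.2 +
                ρ y.1 * ((U ^ q) x.2 y.2 - ρ y.2) := by ring
          rw [e]
          refine (abs_add_le _ _).trans_eq ?_
          rw [abs_mul, abs_mul, abs_of_nonneg (pow_apply_nonneg hU0 q x.2 y.2),
            abs_of_nonneg (hρ0 y.1)]
      _ = d x.1 p + d x.2 q := by
          rw [Fintype.sum_prod_type]
          simp only [Finset.sum_add_distrib, ← Finset.mul_sum, ← Finset.sum_mul,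
            sum_pow_apply hU1, hρ1, mul_one, one_mul]
          rfl
  have hstep : ∀ s, ∑ y : V × V, |(W ^ s) x y - ρ y.1 * ρ y.2| ≤
      ∑ r ∈ Finset.range (s + 1), (1 / 2 : ℝ) ^ s * (s.choose r : ℝ) * d x.1 r +
        ∑ r ∈ Finset.range (s + 1), (1 / 2 : ℝ) ^ s * (s.choose r : ℝ) * d x.2 r := by
    intro s
    have hone : ∑ r ∈ Finset.range (s + 1), (1 / 2 : ℝ) ^ s * (s.choose r : ℝ) = 1 := by
      rw [← Finset.mul_sum, ← Nat.cast_sum, Nat.sum_range_choose]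
      push_cast
      rw [← mul_pow]; norm_num
    have hflip : ∑ r ∈ Finset.range (s + 1), (1 / 2 : ℝ) ^ s * (s.choose r : ℝ) * d x.2 r =
        ∑ r ∈ Finset.range (s + 1), (1 / 2 : ℝ) ^ s * (s.choose r : ℝ) * d x.2 (s - r) := by
      rw [← Finset.sum_flip]
      refine Finset.sum_congr rfl fun r hr => ?_
      rw [Nat.choose_symm (Nat.lt_succ_iff.1 (Finset.mem_range.1 hr))]
    rw [hflip, ← Finset.sum_add_distrib]
    calc ∑ y : V × V, |(W ^ s) x y - ρ y.1 * ρ y.2|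
        ≤ ∑ y : V × V, ∑ r ∈ Finset.range (s + 1), (1 / 2 : ℝ) ^ s * (s.choose r : ℝ) *
            |(U ^ r) x.1 y.1 * (U ^ (s - r)) x.2 y.2 - ρ y.1 * ρ y.2| := by
          refine Finset.sum_le_sum fun y _ => ?_
          have e : (W ^ s) x y - ρ y.1 * ρ y.2 = ∑ r ∈ Finset.range (s + 1),
              (1 / 2 : ℝ) ^ s * (s.choose r : ℝ) *
                ((U ^ r) x.1 y.1 * (U ^ (s - r)) x.2 y.2 - ρ y.1 * ρ y.2) := by
            simp only [mul_sub ((1 / 2 : ℝ) ^ s * _), Finset.sum_sub_distrib, ← Finset.sum_mul,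
              hone, one_mul, pow_apply_of_average hW]
          rw [e]
          refine (Finset.abs_sum_le_sum_abs _ _).trans_eq (Finset.sum_congr rfl fun r _ => ?_)
          rw [abs_mul, abs_of_nonneg (by positivity)]
      _ = ∑ r ∈ Finset.range (s + 1), (1 / 2 : ℝ) ^ s * (s.choose r : ℝ) *
            ∑ y : V × V, |(U ^ r) x.1 y.1 * (U ^ (s - r)) x.2 y.2 - ρ y.1 * ρ y.2| := by
          rw [Finset.sum_comm]; simp only [Finset.mul_sum]
      _ ≤ _ := by
          refine Finset.sum_le_sum fun r _ => ?_
          rw [← mul_add]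
          exact mul_le_mul_of_nonneg_left (hprod r (s - r)) (by positivity)
  refine (Finset.sum_le_sum fun s _ => hstep s).trans ?_
  rw [Finset.sum_add_distrib]
  linarith [sum_binomial_average_le (hd x.1) (hU x.1) t,
    sum_binomial_average_le (hd x.2) (hU x.2) t]

lemma eigen_of_average (hW : W = (1 / 2 : ℝ) • (Matrix.kronecker U 1 + Matrix.kronecker 1 U))
    {l l' : ℝ} {f f' : V → ℂ} (hf : ∀ i, ∑ r, (U i r : ℂ) * f r = l * f i)
    (hf' : ∀ i, ∑ r, (U i r : ℂ) * f' r = l' * f' i) (x : V × V) :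
    ∑ y : V × V, (W x y : ℂ) * (f y.1 * f' y.2) =
      (((l + l') / 2 : ℝ) : ℂ) * (f x.1 * f' x.2) := by
  have e : ∀ y : V × V, (W x y : ℂ) * (f y.1 * f' y.2) =
      1 / 2 * (((U x.1 y.1 : ℂ) * f y.1) * (if x.2 = y.2 then f' y.2 else 0) +
        (if x.1 = y.1 then f y.1 else 0) * ((U x.2 y.2 : ℂ) * f' y.2)) := by
    intro y
    rw [hW]
    simp only [Matrix.smul_apply, Matrix.add_apply, Matrix.kronecker, Matrix.kroneckerMap_apply,
      Matrix.one_apply, smul_eq_mul]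
    split_ifs <;> push_cast <;> ring
  simp only [e, ← Finset.mul_sum, Finset.sum_add_distrib, Fintype.sum_prod_type,
    ← Finset.sum_mul, Finset.sum_ite_eq, Finset.mem_univ, if_true, hf, hf']
  push_cast
  ring

end Product

/-! ### The grid with wraparounds -/

section Torus

variable {k : ℕ} {ω : ℝ}

lemma commMatrix_torus_eq_average (ω : ℝ) :
    commMatrix (torusGrid (k + 3)) ω =
      (1 / 2 : ℝ) • (Matrix.kronecker (commMatrix (SimpleGraph.cycleGraph (k + 3)) ω) 1 +
        Matrix.kronecker 1 (commMatrix (SimpleGraph.cycleGraph (k + 3)) ω)) := by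
  ext x y
  simp only [Matrix.smul_apply, Matrix.add_apply, Matrix.kronecker, Matrix.kroneckerMap_apply,
    Matrix.one_apply, smul_eq_mul]
  by_cases hxy : x = y
  · subst hxy
    simp only [commMatrix_apply_self, if_true]
    ring
  · by_cases h : (torusGrid (k + 3)).Adj x y
    · classical
      rw [commMatrix_apply_of_adj h, SimpleGraph.degree_boxProd,
        SimpleGraph.cycleGraph_degree_three_le, SimpleGraph.cycleGraph_degree_three_le]
      rcases SimpleGraph.boxProd_adj.1 h with ⟨h1, h2⟩ | ⟨h1, h2⟩
      · rw [if_pos h2, if_neg h1.ne, commMatrix_apply_of_adj h1,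
          SimpleGraph.cycleGraph_degree_three_le]
        push_cast; ring
      · rw [if_pos h2, if_neg h1.ne, commMatrix_apply_of_adj h1,
          SimpleGraph.cycleGraph_degree_three_le]
        push_cast; ring
    · rw [commMatrix_apply_of_not_adj hxy h]
      rw [SimpleGraph.boxProd_adj, not_or] at h
      by_cases h1 : x.1 = y.1
      · have h2 : x.2 ≠ y.2 := fun h2 => hxy (Prod.ext h1 h2)
        rw [if_neg h2, if_pos h1, commMatrix_apply_of_not_adj h2 fun h' => h.2 ⟨h', h1⟩]
        ring
      · by_cases h2 : x.2 = y.2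
        · rw [if_pos h2, if_neg h1, commMatrix_apply_of_not_adj h1 fun h' => h.1 ⟨h', h2⟩]
          ring
        · rw [if_neg h1, if_neg h2]
          ring

lemma commMatrix_nonneg {V : Type} [Fintype V] (G : SimpleGraph V) (h0 : 0 ≤ ω) (h1 : ω ≤ 1)
    (i j : V) : 0 ≤ commMatrix G ω i j := by
  have : 0 ≤ 1 - ω := by linarith
  simp only [commMatrix, Matrix.of_apply]
  split_ifs <;> positivity

lemma mixesWithin_torus (h0 : 0 < ω) (h1 : ω < 1) :
    MixesWithin (commMatrix (torusGrid (k + 3)) ω)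
      (fun _ => 1 / ((k + 3 : ℕ) : ℝ) * (1 / ((k + 3 : ℕ) : ℝ)))
      (4 * cycleMixingSum (k + 3) ω) := by
  have hne : ((k + 3 : ℕ) : ℝ) ≠ 0 := by exact_mod_cast (by omega : k + 3 ≠ 0)
  have hnn : ∀ _ : Fin (k + 3), 0 ≤ 1 / ((k + 3 : ℕ) : ℝ) := fun _ => by positivity
  have hsum : ∑ _i : Fin (k + 3), 1 / ((k + 3 : ℕ) : ℝ) = 1 := by
    rw [Finset.sum_const, Finset.card_univ, Fintype.card_fin, nsmul_eq_mul, mul_one_div_cancel hne]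
  have h := MixesWithin.average (commMatrix_nonneg _ h0.le h1.le)
    (sum_commMatrix_cycle_eq_one (n := k) ω) hnn hsum (mixesWithin_cycle h0 h1)
    (commMatrix_torus_eq_average ω)
  exact h

lemma spectralGap_torus_le_of_eigenvalues (a b : Fin (k + 3))
    (h : (cycleEigenvalue ω a + cycleEigenvalue ω b) / 2 ≠ 1) :
    spectralGap (commMatrix (torusGrid (k + 3)) ω) ≤
      1 - |(cycleEigenvalue ω a + cycleEigenvalue ω b) / 2| := by
  have he := eigen_of_average (commMatrix_torus_eq_average (k := k) ω) (cycleChar_mul_eigen ω a)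
    (cycleChar_mul_eigen ω b)
  have hne : (fun x : Fin (k + 3) × Fin (k + 3) =>
      cycleChar (a * x.1) * cycleChar (b * x.2)) ≠ 0 := Function.ne_iff.2
    ⟨(0, 0), mul_ne_zero (cycleChar_ne_zero (a * 0)) (cycleChar_ne_zero (b * 0))⟩
  exact spectralGap_le_of_real_eigenvector h hne he

lemma spectralGap_torus_le (h1 : ω < 1) :
    spectralGap (commMatrix (torusGrid (k + 3)) ω) ≤
      2 * (1 - ω) * Real.sin (Real.pi / (k + 3 : ℕ)) ^ 2 := by
  have hz : cycleEigenvalue ω (0 : Fin (k + 3)) = 1 := by simp [cycleEigenvalue]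
  have hne := cycleEigenvalue_one_ne (n := k) h1
  -- The mode `(1, 0)` gives a gap of at most half of the claimed bound, as only one coordinate
  -- oscillates.
  have h := spectralGap_torus_le_of_eigenvalues (ω := ω) (1 : Fin (k + 3)) 0
    (by rw [hz]; intro h; apply hne; linarith)
  have := le_abs_self ((cycleEigenvalue ω (1 : Fin (k + 3)) +
    cycleEigenvalue ω (0 : Fin (k + 3))) / 2)
  rw [hz, cycleEigenvalue_one] at h this
  have : 0 ≤ (1 - ω) * Real.sin (Real.pi / (k + 3 : ℕ)) ^ 2 :=
    mul_nonneg (by linarith) (sq_nonneg _)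
  linarith

lemma spectralGap_torus_le_of_even (h1 : ω < 1) (he : Even (k + 3)) :
    spectralGap (commMatrix (torusGrid (k + 3)) ω) ≤ 2 * ω := by
  obtain ⟨a, ha⟩ := exists_cycleEigenvalue_eq ω he
  have h := spectralGap_torus_le_of_eigenvalues (ω := ω) a a (by rw [ha]; intro h; linarith)
  rw [ha] at h
  have := neg_abs_le ((2 * ω - 1 + (2 * ω - 1)) / 2)
  linarith

end Torus

/-! ### The decentralization cost on the three networks -/

section Networks

variable {B ι δ ω : ℝ}

lemma one_sub_abs_pos (h0 : 0 < ω) (h1 : ω < 1) : 0 < 1 - |2 * ω - 1| := by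
  have : |2 * ω - 1| < 1 := abs_lt.2 ⟨by linarith, by linarith⟩
  linarith

lemma min_gap_pos {N : ℕ} (hN : 2 ≤ N) (h0 : 0 < ω) (h1 : ω < 1) :
    0 < min (1 - |2 * ω - 1|) (2 * (1 - ω) * Real.sin (Real.pi / N) ^ 2) := by
  have hN' : (2 : ℝ) ≤ N := by exact_mod_cast hN
  have hsin : 0 < Real.sin (Real.pi / N) := by
    refine Real.sin_pos_of_pos_of_lt_pi (by have := Real.pi_pos; positivity) ?_
    rw [div_lt_iff₀ (by linarith)]
    nlinarith [Real.pi_pos]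
  have : 0 < 1 - ω := by linarith
  exact lt_min (one_sub_abs_pos h0 h1) (by positivity)

lemma cycleMixingSum_mul_min_le {N : ℕ} (hN : 1 ≤ N) (h0 : 0 < ω) (h1 : ω < 1) :
    cycleMixingSum N ω *
      min (1 - |2 * ω - 1|) (2 * (1 - ω) * Real.sin (Real.pi / N) ^ 2) ≤ 61 := by
  refine cycleMixingSum_mul_le hN h0 h1 (min_le_right _ _) fun _ => (min_le_left _ _).trans ?_
  linarith [neg_abs_le (2 * ω - 1)]

/-- The star needs only `K = 3` and the cycle `61`; the common value `244 = 4 * 61` is dictated by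
the grid. -/
lemma costBound_star {n : ℕ} (c : Fin n) (hB : 0 < B) (hι : 0 < ι) (hδ : 0 < δ) (hn : 3 ≤ n)
    (hδn : 1 / δ ≤ n) (h0 : 0 < ω) (h1 : ω < 1) :
    CostBound.{u, v} (commMatrix (SimpleGraph.starGraph c) ω) B ι δ
      (fun m T => costConst B ι 244 *
        (Real.log (n * m * T) / min (1 - ω) (1 - |2 * ω - 1|))) := by
  have ha := one_sub_abs_pos h0 h1
  have hb : 0 < 1 - ω := by linarith
  have hγ : 0 < min (1 - ω) (1 - |2 * ω - 1|) := lt_min hb ha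
  have hS : (1 / (1 - |2 * ω - 1|) + 2 * (1 / (1 - ω))) * min (1 - ω) (1 - |2 * ω - 1|) ≤ 3 := by
    have e1 : 1 / (1 - |2 * ω - 1|) * min (1 - ω) (1 - |2 * ω - 1|) ≤ 1 := by
      rw [one_div_mul_eq_div, div_le_one ha]; exact min_le_right _ _
    have e2 : 1 / (1 - ω) * min (1 - ω) (1 - |2 * ω - 1|) ≤ 1 := by
      rw [one_div_mul_eq_div, div_le_one hb]; exact min_le_left _ _
    linarith
  have hS1 : 1 ≤ 1 / (1 - |2 * ω - 1|) + 2 * (1 / (1 - ω)) := by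
    have : 1 ≤ 1 / (1 - ω) := by rw [le_div_iff₀ hb]; linarith
    have : 0 < 1 / (1 - |2 * ω - 1|) := by positivity
    linarith
  have h := costBound_of_mixesWithin.{u, v} hB hι hδ (mixesWithin_star c ω (by omega) h0 h1) hS1
    (K := 244) (γ := min (1 - ω) (1 - |2 * ω - 1|))
    ((mul_le_mul_of_nonneg_left (spectralGap_star_le c ω hn h0 h1) (by linarith)).trans
      (hS.trans (by norm_num))) hγ ((min_le_left _ _).trans (by linarith))
    (hS.trans (by norm_num)) (by simpa using hn) (by simpa using hδn)
  simpa only [Fintype.card_fin] using h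

lemma costBound_cycle {n : ℕ} (hB : 0 < B) (hι : 0 < ι) (hδ : 0 < δ) (hn : 3 ≤ n)
    (hδn : 1 / δ ≤ n) (h0 : 0 < ω) (h1 : ω < 1) :
    CostBound.{u, v} (commMatrix (SimpleGraph.cycleGraph n) ω) B ι δ
      (fun m T => costConst B ι 244 * (Real.log (n * m * T) /
        min (1 - |2 * ω - 1|) (2 * (1 - ω) * Real.sin (Real.pi / n) ^ 2))) := by
  obtain ⟨q, rfl⟩ : ∃ q, n = q + 3 := ⟨n - 3, by omega⟩
  have h := costBound_of_mixesWithin.{u, v} hB hι hδ (mixesWithin_cycle (n := q) h0 h1)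
    (one_le_cycleMixingSum (by omega) h0 h1) (K := 244)
    (γ := min (1 - |2 * ω - 1|) (2 * (1 - ω) * Real.sin (Real.pi / (q + 3 : ℕ)) ^ 2))
    ((cycleMixingSum_mul_le (by omega) h0 h1 (spectralGap_cycle_le h1)
      (spectralGap_cycle_le_of_even h1)).trans (by norm_num))
    (min_gap_pos (by omega) h0 h1)
    ((min_le_left _ _).trans (by linarith [abs_nonneg (2 * ω - 1)]))
    ((cycleMixingSum_mul_min_le (by omega) h0 h1).trans (by norm_num)) (by simp)
    (by simpa using hδn)
  simpa only [Fintype.card_fin] using h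

lemma costBound_torus {k : ℕ} (hB : 0 < B) (hι : 0 < ι) (hδ : 0 < δ) (hk : 3 ≤ k)
    (hδk : 1 / δ ≤ (k * k : ℕ)) (h0 : 0 < ω) (h1 : ω < 1) :
    CostBound.{u, v} (commMatrix (torusGrid k) ω) B ι δ
      (fun m T => costConst B ι 244 * (Real.log ((k * k : ℕ) * m * T) /
        min (1 - |2 * ω - 1|) (2 * (1 - ω) * Real.sin (Real.pi / k) ^ 2))) := by
  obtain ⟨q, rfl⟩ : ∃ q, k = q + 3 := ⟨k - 3, by omega⟩
  have hcard : Fintype.card (Fin (q + 3) × Fin (q + 3)) = (q + 3) * (q + 3) := by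
    rw [Fintype.card_prod, Fintype.card_fin]
  have hS := one_le_cycleMixingSum (N := q + 3) (by omega) h0 h1
  have h := costBound_of_mixesWithin.{u, v} hB hι hδ (mixesWithin_torus (k := q) h0 h1)
    (by linarith) (K := 244)
    (γ := min (1 - |2 * ω - 1|) (2 * (1 - ω) * Real.sin (Real.pi / (q + 3 : ℕ)) ^ 2))
    (by
      have := cycleMixingSum_mul_le (N := q + 3) (by omega) h0 h1 (spectralGap_torus_le h1)
        (spectralGap_torus_le_of_even h1)
      linarith)
    (min_gap_pos (by omega) h0 h1)
    ((min_le_left _ _).trans (by linarith [abs_nonneg (2 * ω - 1)]))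
    (by
      have := cycleMixingSum_mul_min_le (N := q + 3) (by omega) h0 h1
      linarith)
    (by rw [hcard]; nlinarith) (by rw [hcard]; exact hδk)
  simpa only [hcard] using h

end Networks

end DistributedDetection

theorem corollary1 (B ι : ℝ) (hB : 0 < B) (hι : 0 < ι) :
    ∃ C : ℝ, 0 < C ∧ ∀ δ : ℝ, 0 < δ → δ < 1 → ∃ N : ℕ, ∀ n : ℕ, N ≤ n →
      ∀ ω : ℝ, 0 < ω → ω < 1 →
        -- star network with `n` agents and centre `c`
        (∀ c : Fin n, DistributedDetection.CostBound.{u, v}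
          (DistributedDetection.commMatrix (SimpleGraph.starGraph c) ω) B ι δ
          (fun m T => C * (Real.log (n * m * T) / min (1 - ω) (1 - |2 * ω - 1|)))) ∧
        -- cycle network with `n` agents
        DistributedDetection.CostBound.{u, v}
          (DistributedDetection.commMatrix (SimpleGraph.cycleGraph n) ω) B ι δ
          (fun m T => C * (Real.log (n * m * T) /
            min (1 - |2 * ω - 1|) (2 * (1 - ω) * Real.sin (Real.pi / n) ^ 2))) ∧
        -- grid network (with wraparounds) with `n = k * k` agents
        (∀ k : ℕ, n = k * k → DistributedDetection.CostBound.{u, v}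
          (DistributedDetection.commMatrix (DistributedDetection.torusGrid k) ω) B ι δ
          (fun m T => C * (Real.log (n * m * T) /
            min (1 - |2 * ω - 1|)
              (2 * (1 - ω) * Real.sin (Real.pi / Real.sqrt n) ^ 2)))) := by
  -- The bound `9` forces side length at least `3` when `n = k * k`, and `⌈1 / δ⌉₊` makes the
  -- failure probability `1 / n` at most `δ`.
  refine ⟨DistributedDetection.costConst B ι 244,
    DistributedDetection.costConst_pos hB hι (by norm_num), fun δ hδ _ =>
      ⟨max 9 ⌈1 / δ⌉₊, fun n hn ω h0 h1 => ?_⟩⟩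
  have hn9 : 9 ≤ n := (le_max_left _ _).trans hn
  have hδn : 1 / δ ≤ n := Nat.ceil_le.1 ((le_max_right _ _).trans hn)
  refine ⟨fun c => DistributedDetection.costBound_star c hB hι hδ (by omega) hδn h0 h1,
    DistributedDetection.costBound_cycle hB hι hδ (by omega) hδn h0 h1, fun k hk => ?_⟩
  subst hk
  have hsqrt : Real.sqrt ((k * k : ℕ) : ℝ) = k := by
    rw [Nat.cast_mul, Real.sqrt_mul_self (Nat.cast_nonneg k)]
  rw [hsqrt]
  exact DistributedDetection.costBound_torus hB hι hδ (by nlinarith) hδn h0 h1
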